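/- \textbf{Theorem (Bounded temperature-zero regret for online DPO).} \emph{Setting.} Let $\mathcal X$ be a measurable space, $\mathcal A$ a separable metric space with its Borel $\sigma$-algebra, $d_0$ a probability measure on $\mathcal X$, $\pi_0(\cdot\mid x)$ a Markov kernel from $\mathcal X$ to $\mathcal A$, $S_x$ the topological support of $\pi_0(\cdot\mid x)$, and $\eta>0$. Let $(R_p)_{p\in\mathcal P}$ be measurable functions $R_p:\mathcal X\times\mathcal A\to\mathbb R$ with $\int R_p(x,a)\,\pi_0(da\mid x)=0$ for all $x$, and $\mathcal F=\{R_p:p\in\mathcal P\}$. Write $\|R\|=\sup\{|R(x,a)|:x\in\mathcal X,\ a\in S_x\}$. For each reward $R\in\mathcal F\cup\{0\}$ fix a measurable selector $a_R(x)\in\arg\max_{a\in S_x}R(x,a)$, and let $a_p=a_{R_p}$. Assume: (C1) every $R\in\mathcal F$ has $\|R\|<\infty$, $\mathcal F$ is compact for $\|\cdot\|$, and for each $R\in\mathcal F$ the map $a\mapsto R(x,a)$ is continuous on $S_x$ for $d_0$-a.e. $x$; (C2) there is $\Delta_{\min}>0$ such that for every $p\in\mathcal P$ and $d_0$-a.e.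 $x$, $R_p(x,a)+\Delta_{\min}\le R_p(x,a_p(x))$ for all $a\in S_x$ with $a\neq a_p(x)$. For a reward $R$ let $\pi_R(da\mid x)\propto e^{\eta R(x,a)}\pi_0(da\mid x)$, with density $\frac{d\pi_R(\cdot\mid x)}{d\pi_0(\cdot\mid x)}(a)=e^{\eta R(x,a)}\big/\int e^{\eta R(x,a')}\pi_0(da'\mid x)$ for all $x,a$, and let $\Pi=\{\pi_R:R\in\mathcal F\}$. For each $\pi\in\Pi$ choose any $R\in\mathcal F$ with $\pi=\pi_R$; the density of $\pi$ is the one displayed for this $R$, and $a_\pi=a_R$. For $\pi=\pi_0$ put $a_{\pi_0}=a_0$, the selector of the zero reward. For $p\in\mathcal P$ define $$\mathcal G_p(R)=\mathbb E_{X\sim d_0}[R_p(X,a_p(X))-R_p(X,a_R(X))],\qquad \mathcal G^{\mathrm{DPO}}_p(\pi)=\mathbb E_{X\sim d_0}[R_p(X,a_p(X))-R_p(X,a_\pi(X))].$$ \emph{Exact online DPO under truth $p$.} Put $\widehat\pi_0=\pi_0$. In round $t\ge1$, given the previous rounds, $x_t\sim d_0$; then $a_{t,1},a_{t,2}$ are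 i.i.d. from $\widehat\pi_{t-1}(\cdot\mid x_t)$; then $y_t\in\{1,2\}$ equals $k$ with probability $e^{R_p(x_t,a_{t,k})}/\sum_{l=1}^2e^{R_p(x_t,a_{t,l})}$. After round $t$, $\widehat\pi_t$ is (almost surely) a minimizer over $\pi\in\Pi$ of $$\frac1t\sum_{s=1}^t-\log\sigma\Big(\frac1\eta\Big[\log\frac{d\pi(\cdot\mid x_s)}{d\pi_0(\cdot\mid x_s)}(a_{s,y_s})-\log\frac{d\pi(\cdot\mid x_s)}{d\pi_0(\cdot\mid x_s)}(a_{s,3-y_s})\Big]\Big),\qquad\sigma(u)=\frac1{1+e^{-u}},$$ chosen measurably from the data of the first $t$ rounds, i.e. as a Markov kernel from (data, context) to actions. $\mathbb E_p$ is the expectation over this process. \emph{Constants.} Let $B=\sup_{R\in\mathcal F}\|R\|$, $\beta=e^{2\eta B}$, $\Delta_{\max}=\sup_{p\in\mathcal P,\,x\in\mathcal X,\,a\in S_x}(R_p(x,a_p(x))-R_p(x,a))$, and let $\mathcal N(\mathcal F,\varepsilon)$ be the least number of closed $\|\cdot\|$-balls of radius $\varepsilon$ with centres in $\mathcal F$ that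 cover $\mathcal F$. Let $\mathcal L_p(R)=\mathbb E[\log(e^{R(X,A_1)}+e^{R(X,A_2)})-R(X,A_Y)]$, where $X\sim d_0$, $A_1,A_2$ are i.i.d. from $\pi_0(\cdot\mid X)$, and $Y=k$ with probability $e^{R_p(X,A_k)}/\sum_{l=1}^2e^{R_p(X,A_l)}$. \emph{Conclusion.} (i) If $R,R'\in\mathcal F$ and $\pi_R=\pi_{R'}$, then $a_R=a_{R'}$ $d_0$-a.s., so $a_\pi$ is well defined $d_0$-a.s. (ii) There is $\varepsilon_0>0$ such that $\mathcal G_p(R_q)\in\{0\}\cup[\varepsilon_0,\infty)$ for all $p,q\in\mathcal P$; and for every $\varepsilon_0>0$ there is $\gamma_0>0$ such that $\mathcal G_p(R_q)\ge\varepsilon_0$ implies $\mathcal L_p(R_q)-\mathcal L_p(R_p)\ge\gamma_0$, for all $p,q\in\mathcal P$. (iii) The cumulative regret is bounded uniformly in the truth and the horizon: $$\sup_{p\in\mathcal P}\sup_{T\ge1}\sum_{t=0}^{T-1}\mathbb E_p[\mathcal G^{\mathrm{DPO}}_p(\widehat\pi_t)]<\infty.$$ (iv) More precisely, for all $\varepsilon_0,\gamma_0$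 as in (ii), with $\gamma=\beta^{-2}\gamma_0$, $N_\gamma=\mathcal N(\mathcal F,\gamma/32)$ and $c_\gamma=\dfrac{\gamma^2}{128(\log2+2B)^2}$, the random variables $\mathcal G^{\mathrm{DPO}}_p(\widehat\pi_t)$ are integrable and $$\sup_{p\in\mathcal P}\sup_{T\ge1}\sum_{t=0}^{T-1}\mathbb E_p[\mathcal G^{\mathrm{DPO}}_p(\widehat\pi_t)]\le\Delta_{\max}\Big(1+\Big\lceil\frac1{c_\gamma}\log(2N_\gamma)\Big\rceil+\frac1{e^{c_\gamma}-1}\Big).$$ -/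

import Mathlib

open MeasureTheory ProbabilityTheory
open scoped ENNReal NNReal

noncomputable section

namespace OnlineDPO

variable {X A P : Type*} [MeasurableSpace X]

/-! ### Rewards, choice model, log-loss -/

section Choice

variable {K : ℕ}

/-- Multinomial logit probability that item `k` of the slate `a` is preferred. -/
def choiceProb (R : X → A → ℝ) (x : X) (a : Fin K → A) (k : Fin K) : ℝ :=
  Real.exp (R x (a k)) / ∑ l, Real.exp (R x (a l))

/-- Multinomial log-loss `ℓ(v, y) = log (∑ k, exp (v k)) - v y`. -/
def logLoss (v : Fin K → ℝ) (y : Fin K) : ℝ :=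
  Real.log (∑ k, Real.exp (v k)) - v y

end Choice

/-! ### KL-tilted policies -/

section Tilt

variable [MeasurableSpace A]

/-- The KL-tilted policy `π_R(da ∣ x) ∝ exp (η R(x,a)) π₀(da ∣ x)`. -/
def tiltedPolicy (π₀ : Kernel X A) (η : ℝ) (R : X → A → ℝ) : X → Measure A :=
  fun x => (π₀ x).tilted fun a => η * R x a

/-- The density of `π_R(· ∣ x)` with respect to `π₀(· ∣ x)`, as an everywhere defined function
`exp (η R(x,a)) / ∫ exp (η R(x,a')) π₀(da' ∣ x)`. -/
def tiltDensity (π₀ : Kernel X A) (η : ℝ) (R : X → A → ℝ) (x : X) (a : A) : ℝ :=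
  Real.exp (η * R x a) / ∫ a', Real.exp (η * R x a') ∂(π₀ x)

/-- `tiltDensity` is a version of the Radon--Nikodym derivative of `π_R` with respect to `π₀`. -/
theorem rnDeriv_tiltedPolicy (π₀ : Kernel X A) [IsMarkovKernel π₀] (η : ℝ) (R : X → A → ℝ)
    (x : X) (hR : Measurable (R x)) :
    (tiltedPolicy π₀ η R x).rnDeriv (π₀ x) =ᵐ[π₀ x]
      fun a => ENNReal.ofReal (tiltDensity π₀ η R x a) :=
  rnDeriv_tilted_left_self (hR.const_mul η).aemeasurable

/-- The policy class `{π_R : R in the reward class}`. -/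
def dpoClass (π₀ : Kernel X A) (η : ℝ) (R : P → X → A → ℝ) : Set (X → Measure A) :=
  {π | ∃ q, π = tiltedPolicy π₀ η (R q)}

/-- `rew` chooses, for every policy of the class, some reward of the class inducing it. -/
def IsInducingReward (π₀ : Kernel X A) (η : ℝ) (R : P → X → A → ℝ)
    (rew : (X → Measure A) → X → A → ℝ) : Prop :=
  ∀ π ∈ dpoClass π₀ η R, ∃ q, rew π = R q ∧ π = tiltedPolicy π₀ η (R q)

end Tilt

/-! ### Conditions on the model -/

section Model

variable [MetricSpace A] [MeasurableSpace A]

/-- `a` is a measurable selector of the maximizers of `R(x, ·)` over the topological support of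
`π₀(· ∣ x)`. -/
structure IsSelector (π₀ : Kernel X A) (R : X → A → ℝ) (a : X → A) : Prop where
  measurable : Measurable a
  mem_support : ∀ x, a x ∈ (π₀ x).support
  isMax : ∀ x, ∀ b ∈ (π₀ x).support, R x b ≤ R x (a x)

/-- `R` is `π₀`-centered. -/
def IsCentered (π₀ : Kernel X A) (R : X → A → ℝ) : Prop :=
  ∀ x, Integrable (R x) (π₀ x) ∧ ∫ a, R x a ∂(π₀ x) = 0

/-- The set of all `(x, a)` with `a` in the support of `π₀(· ∣ x)`. -/
def supportGraph (π₀ : Kernel X A) : Set (X × A) :=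
  {z | z.2 ∈ (π₀ z.1).support}

/-- Restriction of a reward to the support graph. -/
def onSupport (π₀ : Kernel X A) (R : X → A → ℝ) : supportGraph π₀ → ℝ :=
  fun z => R z.1.1 z.1.2

/-- The reward class as a subset of `ℓ^∞` of the support graph, i.e. with the distance
`sup {|R(x,a) - R'(x,a)| : a ∈ supp π₀(· ∣ x)}`. -/
def rewardClass (π₀ : Kernel X A) (R : P → X → A → ℝ) :
    Set (lp (fun _ : supportGraph π₀ => ℝ) ∞) :=
  {f | ∃ q, ⇑f = onSupport π₀ (R q)}

/-- Condition (C1): the rewards are bounded on the support graph, the reward class is compact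
in the supremum norm there, and each reward is continuous in the action on the support of
`π₀(· ∣ x)` for almost every `x`. -/
structure CompactContinuous (d₀ : Measure X) (π₀ : Kernel X A) (R : P → X → A → ℝ) : Prop where
  bounded : ∀ q, Memℓp (onSupport π₀ (R q)) ∞
  compact : IsCompact (rewardClass π₀ R)
  continuousOn : ∀ q, ∀ᵐ x ∂d₀, ContinuousOn (R q x) (π₀ x).support

/-- Condition (C2): for every truth the maximizer over the support is unique and beats every
other action of the support by a uniform `δ > 0`, almost surely. -/
def RewardGap (d₀ : Measure X) (π₀ : Kernel X A) (R : P → X → A → ℝ)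
    (sel : (X → A → ℝ) → X → A) : Prop :=
  ∃ δ : ℝ, 0 < δ ∧ ∀ p, ∀ᵐ x ∂d₀, ∀ a ∈ (π₀ x).support, a ≠ sel (R p) x →
    R p x a + δ ≤ R p x (sel (R p) x)

/-- `Δ_max`: the largest suboptimality of an action of the support. -/
def maxGap (π₀ : Kernel X A) (R : P → X → A → ℝ) (sel : (X → A → ℝ) → X → A) : ℝ :=
  sSup {r | ∃ p x, ∃ a ∈ (π₀ x).support, r = R p x (sel (R p) x) - R p x a}

/-- `B`: the supremum of the norms of the rewards on the support graph. -/
def envelope (π₀ : Kernel X A) (R : P → X → A → ℝ) : ℝ :=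
  sSup {r | ∃ f ∈ rewardClass π₀ R, r = ‖f‖}

/-- The covering number at scale `ε` of the reward class in the supremum norm. -/
def coveringNumber (π₀ : Kernel X A) (R : P → X → A → ℝ) (ε : ℝ) : ℕ :=
  (Metric.coveringNumber ε.toNNReal (rewardClass π₀ R)).toNat

end Model

/-! ### Regret and population loss -/

section Regret

variable [MeasurableSpace A]

/-- One-step temperature-zero regret of the recommendation `a` when the true reward is `Rstar`
and `astar` is the optimal selector. -/
def recommendationRegret (d₀ : Measure X) (Rstar : X → A → ℝ) (astar a : X → A) : ℝ :=
  ∫ x, (Rstar x (astar x) - Rstar x (a x)) ∂d₀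

/-- `G_p(R)`: one-step temperature-zero regret of the reward `R'` under the truth `Rstar`. -/
def regret (d₀ : Measure X) (sel : (X → A → ℝ) → X → A) (Rstar R' : X → A → ℝ) : ℝ :=
  recommendationRegret d₀ Rstar (sel Rstar) (sel R')

open Classical in
/-- The temperature-zero recommendation of a policy: the selector of the zero reward for `π₀`
itself, and otherwise the selector of the chosen reward inducing the policy. -/
def policySelector (π₀ : Kernel X A) (sel : (X → A → ℝ) → X → A)
    (rew : (X → Measure A) → X → A → ℝ) (π : X → Measure A) : X → A :=
  if π = (fun x => π₀ x) then sel 0 else sel (rew π)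

/-- `G_p^DPO(π)`: one-step temperature-zero regret of a policy. -/
def policyRegret (d₀ : Measure X) (π₀ : Kernel X A) (sel : (X → A → ℝ) → X → A)
    (rew : (X → Measure A) → X → A → ℝ) (Rstar : X → A → ℝ) (π : X → Measure A) : ℝ :=
  recommendationRegret d₀ Rstar (sel Rstar) (policySelector π₀ sel rew π)

/-- Population log-loss of `R'` under the truth `Rstar` for slates of `K` independent actions
drawn from the reference policy. -/
def populationLoss (K : ℕ) (d₀ : Measure X) (π₀ : Kernel X A) (Rstar R' : X → A → ℝ) : ℝ :=
  ∫ x, ∫ a : Fin K → A, ∑ k, choiceProb Rstar x a k * logLoss (fun l => R' x (a l)) k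
    ∂(Measure.pi fun _ => π₀ x) ∂d₀

/-- `ε` isolates the positive one-step regrets within the reward class from zero. -/
def IsolatesRegret (d₀ : Measure X) (R : P → X → A → ℝ) (sel : (X → A → ℝ) → X → A)
    (ε : ℝ) : Prop :=
  0 < ε ∧ ∀ p q, regret d₀ sel (R p) (R q) = 0 ∨ ε ≤ regret d₀ sel (R p) (R q)

/-- `γ` is a population-loss gap for the regret level `ε`, for slates of size `K`. -/
def IsLossGap (K : ℕ) (d₀ : Measure X) (π₀ : Kernel X A) (R : P → X → A → ℝ)
    (sel : (X → A → ℝ) → X → A) (ε γ : ℝ) : Prop :=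
  0 < γ ∧ ∀ p q, ε ≤ regret d₀ sel (R p) (R q) →
    γ ≤ populationLoss K d₀ π₀ (R p) (R q) - populationLoss K d₀ π₀ (R p) (R p)

end Regret

/-! ### The constant of the regret bound -/

section Bound

variable [MetricSpace A] [MeasurableSpace A]

/-- `γ = β^{-K} γ₀` with `β = exp (2 η B)`. -/
def scaledGap (K : ℕ) (π₀ : Kernel X A) (η : ℝ) (R : P → X → A → ℝ) (γ₀ : ℝ) : ℝ :=
  ((Real.exp (2 * η * envelope π₀ R)) ^ K)⁻¹ * γ₀

/-- `c_γ = γ² / (128 (log K + 2 B)²)`. -/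
def rateConst (K : ℕ) (π₀ : Kernel X A) (R : P → X → A → ℝ) (γ : ℝ) : ℝ :=
  γ ^ 2 / (128 * (Real.log K + 2 * envelope π₀ R) ^ 2)

/-- `Δ_max (1 + ⌈log (2 N_γ) / c_γ⌉ + 1 / (exp c_γ - 1))`, where `γ = β^{-K} γ₀` and `N_γ` is the
covering number of the reward class at scale `γ / 32`. -/
def regretBound (K : ℕ) (π₀ : Kernel X A) (η : ℝ) (R : P → X → A → ℝ)
    (sel : (X → A → ℝ) → X → A) (γ₀ : ℝ) : ℝ :=
  let γ := scaledGap K π₀ η R γ₀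
  let N := coveringNumber π₀ R (γ / 32)
  let c := rateConst K π₀ R γ
  maxGap π₀ R sel * (1 + (⌈1 / c * Real.log (2 * N)⌉ : ℝ) + 1 / (Real.exp c - 1))

end Bound

/-! ### Online interaction with pairwise feedback and exact online DPO -/

section Online

variable [MeasurableSpace A]

/-- One round of data: a context, two actions, and the index of the preferred action. -/
abbrev Obs (X A : Type*) := X × (Fin 2 → A) × Fin 2

/-- A learning rule: the policy fitted from the first `t` rounds of data, which is deployed in
the following round. -/
abbrev Rule (X A : Type*) [MeasurableSpace X] [MeasurableSpace A] :=
  ∀ t : ℕ, Kernel ((Fin t → Obs X A) × X) A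

/-- The policy that a learning rule fits from the history `h`. -/
def fittedPolicy (pol : Rule X A) (t : ℕ) (h : Fin t → Obs X A) : X → Measure A :=
  fun x => pol t (h, x)

/-- The data of the first `t` rounds. -/
def history {Ω : Type*} (Z : ℕ → Ω → Obs X A) (t : ℕ) (ω : Ω) : Fin t → Obs X A :=
  fun s => Z s ω

/-- The DPO empirical loss of the policy `π` on the data `h`. The index `y.rev` is the action that
was not preferred. -/
def dpoLoss (π₀ : Kernel X A) (η : ℝ) (rew : (X → Measure A) → X → A → ℝ) {t : ℕ}
    (h : Fin t → Obs X A) (π : X → Measure A) : ℝ :=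
  1 / (t : ℝ) * ∑ s, match h s with
    | (x, a, y) => -Real.log (Real.sigmoid (1 / η *
        (Real.log (tiltDensity π₀ η (rew π) x (a y))
          - Real.log (tiltDensity π₀ η (rew π) x (a y.rev)))))

/-- Conditional law of the rounds. Given the first `t` rounds, the next context has law `d₀`; given
the context, the two actions are independent draws from the policy fitted on these rounds; given
both, the preferred index follows the multinomial logit model of the true reward. -/
def IsInteraction {Ω : Type*} [MeasurableSpace Ω] (μ : Measure Ω) (d₀ : Measure X)
    (Rstar : X → A → ℝ) (pol : Rule X A) (Z : ℕ → Ω → Obs X A) : Prop :=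
  ∀ (t : ℕ) (f : (Fin t → Obs X A) → Obs X A → ℝ≥0∞), Measurable (Function.uncurry f) →
    ∫⁻ ω, f (history Z t ω) (Z t ω) ∂μ =
      ∫⁻ ω, ∫⁻ x, ∫⁻ a : Fin 2 → A,
        ∑ k, ENNReal.ofReal (choiceProb Rstar x a k) * f (history Z t ω) (x, a, k)
        ∂(Measure.pi fun _ => fittedPolicy pol t (history Z t ω) x) ∂d₀ ∂μ

/-- `Z` is the data stream of exact online DPO with learning rule `pol` when the true reward
is `Rstar`: the first policy is `π₀`, and after every round `t ≥ 1` the fitted policy is almost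
surely a minimizer of the DPO empirical loss over the policy class. -/
structure IsOnlineDPO {Ω : Type*} [MeasurableSpace Ω] (μ : Measure Ω) (d₀ : Measure X)
    (π₀ : Kernel X A) (η : ℝ) (R : P → X → A → ℝ) (rew : (X → Measure A) → X → A → ℝ)
    (Rstar : X → A → ℝ) (pol : Rule X A) (Z : ℕ → Ω → Obs X A) : Prop where
  measurable : ∀ t, Measurable (Z t)
  interaction : IsInteraction μ d₀ Rstar pol Z
  init : ∀ h, fittedPolicy pol 0 h = fun x => π₀ x
  mem_class : ∀ t, 1 ≤ t → ∀ᵐ ω ∂μ, fittedPolicy pol t (history Z t ω) ∈ dpoClass π₀ η R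
  isMin : ∀ t, 1 ≤ t → ∀ᵐ ω ∂μ, IsMinOn (dpoLoss π₀ η rew (history Z t ω)) (dpoClass π₀ η R)
    (fittedPolicy pol t (history Z t ω))

end Online

end OnlineDPO

end

open OnlineDPO

/-!
The regret of a fitted policy is controlled by the probability that it is positive, and this
probability decays exponentially in the number of rounds.

*Finitely many recommendations.* By the gap condition, two rewards of the class at distance less
than the gap have almost surely the same selector (`Standing.sel_ae_eq_of_dist_lt`); as the class
is compact, only finitely many selectors occur up to null sets (`Standing.exists_finset_sel`).
Hence positive regrets are bounded away from zero (`Standing.exists_isolatesRegret`).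

*Regret forces excess loss.* The difference of population losses is the mean Kullback--Leibler
divergence of two logit distributions. If it vanishes, the rewards differ by a function of the
context, which centering makes zero, so that continuity and the gap give equal selectors. The
divergence is Lipschitz in the rewards and the selectors are locally constant, so compactness makes
this quantitative (`Standing.exists_isLossGap`). The same two facts show that a tilted policy
determines the selector of its reward (`Standing.sel_ae_eq_of_tiltedPolicy_eq`).

*Concentration.* The normalizing constant of a tilted policy cancels in the DPO loss, which is
therefore the empirical log-loss of the inducing reward (`Standing.dpoLoss_eq`). All deployed
policies have density at least `β⁻¹` with respect to the reference policy, so a reward of positive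
regret has conditional mean excess loss at least `γ = β⁻² γ₀` in every round
(`Standing.le_integral_excessLoss`), whereas the fitted reward has nonpositive empirical excess
loss. An exponential supermartingale, iterated through the conditional law of the rounds, bounds
the probability of such a discrepancy for one reward (`Standing.measure_sum_obsLoss_le`), and a
`γ / 32`-net makes the bound uniform (`Standing.measure_policyRegret_pos_le`). Summing the
resulting geometric series gives the regret bound (`Standing.sum_integral_policyRegret_le`).

*Measurability.* The gap and continuity make each selector an atom of the reference policy, and
the density of a tilted policy is largest exactly at its own selector. The class of a fitted policy
among the finitely many selectors can thus be read off from the masses it gives to these atoms,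
which are measurable in the data (`Standing.aemeasurable_policyRegret`).
-/

namespace OnlineDPO

/-! ### The multinomial log-loss -/

section LogLoss

variable {K : ℕ} {B ε : ℝ} {u v u' v' : Fin K → ℝ}

/-- Conditional excess log-loss of the score vector `v` when the item is chosen according to the
score vector `u`; it is the Kullback--Leibler divergence of the two logit distributions. -/
noncomputable def excessLoss (u v : Fin K → ℝ) : ℝ :=
  ∑ k, Real.exp (-logLoss u k) * (logLoss v k - logLoss u k)

theorem sum_exp_pos (v : Fin K → ℝ) (k : Fin K) : 0 < ∑ l, Real.exp (v l) :=
  Finset.sum_pos (fun _ _ => Real.exp_pos _) ⟨k, Finset.mem_univ k⟩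

theorem exp_neg_logLoss (v : Fin K → ℝ) (k : Fin K) :
    Real.exp (-logLoss v k) = Real.exp (v k) / ∑ l, Real.exp (v l) := by
  rw [logLoss, neg_sub, Real.exp_sub, Real.exp_log (sum_exp_pos v k)]

theorem choiceProb_eq_exp_neg_logLoss {X A : Type*} (R : X → A → ℝ) (x : X) (a : Fin K → A)
    (k : Fin K) : choiceProb R x a k = Real.exp (-logLoss (fun l => R x (a l)) k) := by
  rw [exp_neg_logLoss, choiceProb]

theorem sum_exp_neg_logLoss [NeZero K] (v : Fin K → ℝ) :
    ∑ k, Real.exp (-logLoss v k) = 1 := by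
  simp_rw [exp_neg_logLoss, ← Finset.sum_div]
  exact div_self (sum_exp_pos v 0).ne'

theorem logLoss_nonneg (v : Fin K → ℝ) (k : Fin K) : 0 ≤ logLoss v k := by
  have h : Real.exp (v k) ≤ ∑ l, Real.exp (v l) :=
    Finset.single_le_sum (f := fun l => Real.exp (v l)) (fun _ _ => (Real.exp_pos _).le)
      (Finset.mem_univ k)
  have := Real.log_le_log (Real.exp_pos _) h
  rw [Real.log_exp] at this
  exact sub_nonneg.2 this

theorem logLoss_le (hv : ∀ l, |v l| ≤ B) (k : Fin K) : logLoss v k ≤ Real.log K + 2 * B := by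
  have hK : (0 : ℝ) < K := by exact_mod_cast k.pos
  have h : ∑ l, Real.exp (v l) ≤ K * Real.exp B := by
    refine (Finset.sum_le_sum fun l _ => Real.exp_le_exp.2 (abs_le.1 (hv l)).2).trans ?_
    simp
  have := Real.log_le_log (sum_exp_pos v k) h
  rw [Real.log_mul hK.ne' (Real.exp_pos _).ne', Real.log_exp] at this
  have := (abs_le.1 (hv k)).1
  rw [logLoss]
  linarith

theorem logLoss_sub_le (h : ∀ l, |v l - v' l| ≤ ε) (k : Fin K) :
    logLoss v k - logLoss v' k ≤ 2 * ε := by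
  have h1 : ∑ l, Real.exp (v l) ≤ Real.exp ε * ∑ l, Real.exp (v' l) := by
    rw [Finset.mul_sum]
    refine Finset.sum_le_sum fun l _ => ?_
    rw [← Real.exp_add, Real.exp_le_exp]
    linarith [(abs_le.1 (h l)).2]
  have := Real.log_le_log (sum_exp_pos v k) h1
  rw [Real.log_mul (Real.exp_pos _).ne' (sum_exp_pos v' k).ne', Real.log_exp] at this
  have := (abs_le.1 (h k)).1
  rw [logLoss, logLoss]
  linarith

theorem abs_logLoss_sub_le (h : ∀ l, |v l - v' l| ≤ ε) (k : Fin K) :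
    |logLoss v k - logLoss v' k| ≤ 2 * ε := by
  rw [abs_sub_le_iff]
  exact ⟨logLoss_sub_le h k, logLoss_sub_le (fun l => by rw [abs_sub_comm]; exact h l) k⟩

/-- Each summand of the excess loss dominates a difference of probabilities; these differences
add up to zero. -/
theorem exp_neg_logLoss_sub_exp_le (u v : Fin K → ℝ) (k : Fin K) :
    Real.exp (-logLoss u k) - Real.exp (-logLoss v k) ≤
      Real.exp (-logLoss u k) * (logLoss v k - logLoss u k) := by
  have h := Real.add_one_le_exp (-(logLoss v k - logLoss u k))
  have h2 : Real.exp (-logLoss v k) =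
      Real.exp (-logLoss u k) * Real.exp (-(logLoss v k - logLoss u k)) := by
    rw [← Real.exp_add]; congr 1; ring
  rw [h2]
  nlinarith [Real.exp_pos (-logLoss u k)]

theorem excessLoss_nonneg [NeZero K] (u v : Fin K → ℝ) : 0 ≤ excessLoss u v := by
  have h := Finset.sum_le_sum fun k (_ : k ∈ Finset.univ) => exp_neg_logLoss_sub_exp_le u v k
  rwa [Finset.sum_sub_distrib, sum_exp_neg_logLoss, sum_exp_neg_logLoss, sub_self] at h

theorem logLoss_eq_of_excessLoss_eq_zero [NeZero K] (h : excessLoss u v = 0) (k : Fin K) :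
    logLoss u k = logLoss v k := by
  have hs : ∑ k, (Real.exp (-logLoss u k) - Real.exp (-logLoss v k)) =
      ∑ k, Real.exp (-logLoss u k) * (logLoss v k - logLoss u k) := by
    rw [Finset.sum_sub_distrib, sum_exp_neg_logLoss, sum_exp_neg_logLoss, sub_self]
    exact h.symm
  have hk := (Finset.sum_eq_sum_iff_of_le fun k _ => exp_neg_logLoss_sub_exp_le u v k).1 hs k
    (Finset.mem_univ k)
  by_contra hne
  have h1 := Real.add_one_lt_exp (x := -(logLoss v k - logLoss u k))
    (fun h0 => hne (by linarith))
  have h2 : Real.exp (-logLoss v k) =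
      Real.exp (-logLoss u k) * Real.exp (-(logLoss v k - logLoss u k)) := by
    rw [← Real.exp_add]; congr 1; ring
  rw [h2] at hk
  nlinarith [Real.exp_pos (-logLoss u k)]

/-- Vanishing excess loss determines the score vector up to an additive constant. -/
theorem sub_eq_sub_of_excessLoss_eq_zero [NeZero K] (h : excessLoss u v = 0) (k l : Fin K) :
    u k - u l = v k - v l := by
  have hk := logLoss_eq_of_excessLoss_eq_zero h k
  have hl := logLoss_eq_of_excessLoss_eq_zero h l
  simp only [logLoss] at hk hl
  linarith

theorem abs_exp_neg_sub_exp_neg_le {a b : ℝ} (ha : 0 ≤ a) (hb : 0 ≤ b) :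
    |Real.exp (-a) - Real.exp (-b)| ≤ |a - b| := by
  have key : ∀ a b : ℝ, 0 ≤ a → Real.exp (-a) - Real.exp (-b) ≤ |a - b| := by
    intro a b ha
    have h := Real.add_one_le_exp (-(b - a))
    have h2 : Real.exp (-b) = Real.exp (-a) * Real.exp (-(b - a)) := by
      rw [← Real.exp_add]; congr 1; ring
    have h3 : Real.exp (-a) ≤ 1 := Real.exp_le_one_iff.2 (by linarith)
    have h4 := neg_abs_le (a - b)
    rw [h2]
    nlinarith [Real.exp_pos (-a), abs_nonneg (a - b)]
  rw [abs_sub_le_iff]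
  exact ⟨key a b ha, by rw [abs_sub_comm]; exact key b a hb⟩

theorem abs_sum_exp_mul_logLoss_sub_le [NeZero K] (hv : ∀ l, |v l| ≤ B)
    (hu : ∀ l, |u l - u' l| ≤ ε) (hvv : ∀ l, |v l - v' l| ≤ ε) :
    |∑ k, Real.exp (-logLoss u k) * logLoss v k - ∑ k, Real.exp (-logLoss u' k) * logLoss v' k| ≤
      2 * (K * (Real.log K + 2 * B) + 1) * ε := by
  have hε : 0 ≤ ε := (abs_nonneg _).trans (hu 0)
  rw [← Finset.sum_sub_distrib]
  refine (Finset.abs_sum_le_sum_abs _ _).trans ?_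
  have hterm : ∀ k ∈ Finset.univ,
      |Real.exp (-logLoss u k) * logLoss v k - Real.exp (-logLoss u' k) * logLoss v' k| ≤
        2 * ε * (Real.log K + 2 * B) + Real.exp (-logLoss u' k) * (2 * ε) := by
    intro k _
    have h1 : Real.exp (-logLoss u k) * logLoss v k - Real.exp (-logLoss u' k) * logLoss v' k =
        (Real.exp (-logLoss u k) - Real.exp (-logLoss u' k)) * logLoss v k +
          Real.exp (-logLoss u' k) * (logLoss v k - logLoss v' k) := by ring
    rw [h1]
    refine (abs_add_le _ _).trans (add_le_add ?_ ?_)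
    · rw [abs_mul, abs_of_nonneg (logLoss_nonneg v k)]
      refine mul_le_mul ?_ (logLoss_le hv k) (logLoss_nonneg v k) (by linarith)
      exact (abs_exp_neg_sub_exp_neg_le (logLoss_nonneg _ _) (logLoss_nonneg _ _)).trans
        (abs_logLoss_sub_le hu k)
    · rw [abs_mul, abs_of_pos (Real.exp_pos _)]
      exact mul_le_mul_of_nonneg_left (abs_logLoss_sub_le hvv k) (Real.exp_pos _).le
  refine (Finset.sum_le_sum hterm).trans (le_of_eq ?_)
  rw [Finset.sum_add_distrib, Finset.sum_const, ← Finset.sum_mul, sum_exp_neg_logLoss]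
  simp
  ring

theorem abs_excessLoss_sub_le [NeZero K] (hu0 : ∀ l, |u l| ≤ B) (hv0 : ∀ l, |v l| ≤ B)
    (hu : ∀ l, |u l - u' l| ≤ ε) (hv : ∀ l, |v l - v' l| ≤ ε) :
    |excessLoss u v - excessLoss u' v'| ≤ 4 * (K * (Real.log K + 2 * B) + 1) * ε := by
  have h1 := abs_sum_exp_mul_logLoss_sub_le hv0 hu hv
  have h2 := abs_sum_exp_mul_logLoss_sub_le hu0 hu hu
  simp only [excessLoss, mul_sub, Finset.sum_sub_distrib]
  rw [abs_le] at *
  constructor <;> linarith [h1.1, h1.2, h2.1, h2.2]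

theorem abs_logLoss_sub_logLoss_le (hu : ∀ l, |u l| ≤ B) (hv : ∀ l, |v l| ≤ B) (k : Fin K) :
    |logLoss v k - logLoss u k| ≤ Real.log K + 2 * B := by
  rw [abs_le]
  constructor <;>
    linarith [logLoss_nonneg u k, logLoss_nonneg v k, logLoss_le hu k, logLoss_le hv k]

theorem excessLoss_le [NeZero K] (hu : ∀ l, |u l| ≤ B) (hv : ∀ l, |v l| ≤ B) :
    excessLoss u v ≤ Real.log K + 2 * B := by
  calc excessLoss u v ≤ ∑ k, Real.exp (-logLoss u k) * (Real.log K + 2 * B) :=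
        Finset.sum_le_sum fun k _ => mul_le_mul_of_nonneg_left
          ((le_abs_self _).trans (abs_logLoss_sub_logLoss_le hu hv k)) (Real.exp_pos _).le
    _ = Real.log K + 2 * B := by rw [← Finset.sum_mul, sum_exp_neg_logLoss, one_mul]

theorem excessLoss_sub_le [NeZero K] (u : Fin K → ℝ) (h : ∀ l, |v l - v' l| ≤ ε) :
    excessLoss u v - 2 * ε ≤ excessLoss u v' := by
  have h1 : excessLoss u v - excessLoss u v' ≤ ∑ k, Real.exp (-logLoss u k) * (2 * ε) := by
    rw [excessLoss, excessLoss, ← Finset.sum_sub_distrib]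
    refine Finset.sum_le_sum fun k _ => ?_
    rw [← mul_sub]
    refine mul_le_mul_of_nonneg_left ?_ (Real.exp_pos _).le
    linarith [logLoss_sub_le h k]
  rw [← Finset.sum_mul, sum_exp_neg_logLoss] at h1
  linarith

/-- Second-order bound for the moment generating function of the loss difference. -/
theorem sum_exp_mul_exp_le [NeZero K] {M r : ℝ} (hr : 0 ≤ r) (hrM : r * M ≤ 1)
    (hD : ∀ k, |logLoss v k - logLoss u k| ≤ M) :
    ∑ k, Real.exp (-logLoss u k) * Real.exp (-r * (logLoss v k - logLoss u k)) ≤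
      1 - r * excessLoss u v + r ^ 2 * M ^ 2 := by
  have hterm : ∀ k ∈ Finset.univ,
      Real.exp (-logLoss u k) * Real.exp (-r * (logLoss v k - logLoss u k)) ≤
      Real.exp (-logLoss u k) * (1 + r ^ 2 * M ^ 2) -
        r * (Real.exp (-logLoss u k) * (logLoss v k - logLoss u k)) := by
    intro k _
    set D := logLoss v k - logLoss u k with hDdef
    have hM : 0 ≤ M := (abs_nonneg _).trans (hD k)
    have h0 : |r * D| ≤ r * M := by
      rw [abs_mul, abs_of_nonneg hr]; exact mul_le_mul_of_nonneg_left (hD k) hr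
    have h1 : |(-r * D)| ≤ 1 := by
      rw [neg_mul, abs_neg]; exact h0.trans hrM
    have h2 := (abs_le.1 (Real.abs_exp_sub_one_sub_id_le h1)).2
    have h3 : (-r * D) ^ 2 ≤ r ^ 2 * M ^ 2 := by
      rw [neg_mul, neg_sq, ← mul_pow, ← sq_abs]
      exact pow_le_pow_left₀ (abs_nonneg _) h0 2
    have h4 : Real.exp (-r * D) ≤ 1 - r * D + r ^ 2 * M ^ 2 := by linarith
    have := mul_le_mul_of_nonneg_left h4 (Real.exp_pos (-logLoss u k)).le
    linarith
  refine (Finset.sum_le_sum hterm).trans (le_of_eq ?_)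
  rw [Finset.sum_sub_distrib, ← Finset.sum_mul, sum_exp_neg_logLoss, ← Finset.mul_sum, excessLoss]
  ring

/-- For two items the log-loss is the logistic loss of the score difference. -/
theorem neg_log_sigmoid_sub (v : Fin 2 → ℝ) (y : Fin 2) :
    -Real.log (Real.sigmoid (v y - v y.rev)) = logLoss v y := by
  have h : Real.sigmoid (v y - v y.rev) = Real.exp (-logLoss v y) := by
    rw [exp_neg_logLoss, Real.sigmoid_def, inv_eq_one_div, div_eq_div_iff (by positivity)
      (sum_exp_pos v y).ne']
    have h2 : Real.exp (v y) * Real.exp (-(v y - v y.rev)) = Real.exp (v y.rev) := by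
      rw [← Real.exp_add]; congr 1; ring
    rw [mul_add, h2, Fin.sum_univ_two]
    fin_cases y <;> simp [add_comm]
  rw [h, Real.log_exp, neg_neg]

end LogLoss

/-! ### Summing the failure probabilities -/

/-- A sequence bounded by `1`, and by `exp (-c (t - n))` beyond `n`, has partial sums at most
`1 + n + 1 / (exp c - 1)`. -/
theorem sum_le_of_le_one_of_le_exp {b : ℕ → ℝ} {c : ℝ} (hc : 0 < c) (n : ℕ) (hb0 : ∀ t, 0 ≤ b t)
    (hb1 : ∀ t, b t ≤ 1) (hb : ∀ t, n < t → b t ≤ Real.exp (-(c * ((t : ℝ) - n)))) (T : ℕ) :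
    ∑ t ∈ Finset.range T, b t ≤ 1 + n + 1 / (Real.exp c - 1) := by
  have hr0 := Real.exp_pos (-c)
  have hr1 : Real.exp (-c) < 1 := by rw [Real.exp_lt_one_iff]; linarith
  have hc1 : 1 < Real.exp c := Real.one_lt_exp_iff.2 hc
  calc ∑ t ∈ Finset.range T, b t ≤ ∑ t ∈ Finset.range (n + 1 + T), b t :=
        Finset.sum_le_sum_of_subset_of_nonneg
          (Finset.range_subset_range.2 (by omega)) fun t _ _ => hb0 t
    _ = ∑ t ∈ Finset.range (n + 1), b t + ∑ k ∈ Finset.range T, b (n + 1 + k) :=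
        Finset.sum_range_add _ _ _
    _ ≤ ∑ t ∈ Finset.range (n + 1), (1 : ℝ) +
          ∑ k ∈ Finset.range T, Real.exp (-c) * Real.exp (-c) ^ k := by
        refine add_le_add (Finset.sum_le_sum fun t _ => hb1 t) (Finset.sum_le_sum fun k _ => ?_)
        refine (hb _ (by omega)).trans (le_of_eq ?_)
        rw [← Real.exp_nat_mul, ← Real.exp_add]
        congr 1
        push_cast
        ring
    _ ≤ 1 + n + 1 / (Real.exp c - 1) := by
        rw [← Finset.mul_sum]
        have h1 : ∑ k ∈ Finset.range T, Real.exp (-c) ^ k ≤ (1 - Real.exp (-c))⁻¹ :=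
          (Summable.sum_le_tsum _ (fun k _ => by positivity)
            (summable_geometric_of_lt_one hr0.le hr1)).trans
            (tsum_geometric_of_lt_one hr0.le hr1).le
        have h2 : Real.exp (-c) * (1 - Real.exp (-c))⁻¹ = 1 / (Real.exp c - 1) := by
          rw [← div_eq_mul_inv, div_eq_div_iff (by linarith) (by linarith), mul_sub,
            ← Real.exp_add]
          simp
        have h3 := mul_le_mul_of_nonneg_left h1 hr0.le
        rw [h2] at h3
        simp only [Finset.sum_const, Finset.card_range, nsmul_eq_mul, mul_one]
        push_cast
        linarith

/-! ### Supports -/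

section Support

variable {X A : Type*} [MeasurableSpace X] [MetricSpace A] [SecondCountableTopology A]
  [MeasurableSpace A] [BorelSpace A]

theorem measurableSet_supportGraph (π₀ : Kernel X A) : MeasurableSet (supportGraph π₀) := by
  have h : (supportGraph π₀)ᶜ = ⋃ U ∈ TopologicalSpace.countableBasis A,
      {x | π₀ x U = 0} ×ˢ U := by
    ext ⟨x, a⟩
    have hb := ((TopologicalSpace.isBasis_countableBasis A).nhds_hasBasis
      (a := a)).notMem_measureSupport (μ := π₀ x)
    simp only [supportGraph, Set.mem_compl_iff, Set.mem_ofPred_eq, Set.mem_iUnion, Set.mem_prod,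
      exists_prop]
    rw [hb]
    constructor
    · rintro ⟨U, ⟨hU, ha⟩, h0⟩; exact ⟨U, hU, h0, ha⟩
    · rintro ⟨U, hU, h0, ha⟩; exact ⟨U, ⟨hU, ha⟩, h0⟩
  rw [← MeasurableSet.compl_iff, h]
  refine MeasurableSet.biUnion (TopologicalSpace.countable_countableBasis A) fun U hU => ?_
  have hUm := ((TopologicalSpace.isBasis_countableBasis A).isOpen hU).measurableSet
  exact (Kernel.measurable_coe π₀ hUm (measurableSet_singleton 0)).prod hUm

omit [SecondCountableTopology A] [BorelSpace A] in
/-- Functions continuous on the support that agree almost everywhere agree on the whole support,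
because every relative neighbourhood of a point of the support has positive mass. -/
theorem eqOn_support_of_ae_eq {μ : Measure A} (hμ : ∀ᵐ a ∂μ, a ∈ μ.support) {f g : A → ℝ}
    (hf : ContinuousOn f μ.support) (hg : ContinuousOn g μ.support) (h : f =ᵐ[μ] g) :
    Set.EqOn f g μ.support := by
  intro a ha
  by_contra hne
  have hd : ∀ᶠ b in nhdsWithin a μ.support, f b - g b ≠ 0 :=
    ((hf a ha).sub (hg a ha)).eventually_ne (sub_ne_zero.2 hne)
  obtain ⟨U, hU, hUs⟩ := mem_nhdsWithin_iff_exists_mem_nhds_inter.1 hd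
  have hpos := (Measure.mem_support_iff_forall a).1 ha U hU
  refine hpos.ne' ?_
  rw [← nonpos_iff_eq_zero]
  refine (measure_mono_ae ?_).trans_eq (measure_empty (μ := μ))
  filter_upwards [h, hμ] with b hb hbs hbU
  exact hUs ⟨hbU, hbs⟩ (sub_eq_zero.2 hb)

omit [SecondCountableTopology A] [BorelSpace A] in
/-- A maximizer over the support that beats every other point of the support by a fixed margin is
an atom, since continuity makes it isolated in the support. -/
theorem measure_singleton_pos_of_gap {μ : Measure A} (hμ : ∀ᵐ a ∂μ, a ∈ μ.support) {f : A → ℝ}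
    (hf : ContinuousOn f μ.support) {a : A} (ha : a ∈ μ.support) {δ : ℝ} (hδ : 0 < δ)
    (hgap : ∀ b ∈ μ.support, b ≠ a → f b + δ ≤ f a) : 0 < μ {a} := by
  have hd : ∀ᶠ b in nhdsWithin a μ.support, f a - δ < f b :=
    (hf a ha).eventually (lt_mem_nhds (by linarith))
  obtain ⟨U, hU, hUs⟩ := mem_nhdsWithin_iff_exists_mem_nhds_inter.1 hd
  refine ((Measure.mem_support_iff_forall a).1 ha U hU).trans_le (measure_mono_ae ?_)
  filter_upwards [hμ] with b hbs hbU
  by_contra hne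
  have h1 : f a - δ < f b := hUs ⟨hbU, hbs⟩
  linarith [hgap b hbs hne]

end Support

/-! ### Consequences of compactness and of the gap condition -/

/-- The standing assumptions, with an explicit gap `δ` for all rewards of the class. -/
structure Standing {X A P : Type*} [MeasurableSpace X] [MetricSpace A] [MeasurableSpace A]
    (d₀ : Measure X) (π₀ : Kernel X A) (R : P → X → A → ℝ) (sel : (X → A → ℝ) → X → A)
    (δ : ℝ) : Prop where
  measurable : ∀ p, Measurable (Function.uncurry (R p))
  centered : ∀ p, IsCentered π₀ (R p)
  selector : ∀ p, IsSelector π₀ (R p) (sel (R p))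
  selector_zero : IsSelector π₀ 0 (sel 0)
  compactContinuous : CompactContinuous d₀ π₀ R
  pos : 0 < δ
  gap : ∀ p, ∀ᵐ x ∂d₀, ∀ a ∈ (π₀ x).support, a ≠ sel (R p) x → R p x a + δ ≤ R p x (sel (R p) x)

section Model

variable {X A P : Type*} [MeasurableSpace X] [MetricSpace A] [MeasurableSpace A]
  {d₀ : Measure X} {π₀ : Kernel X A} {R : P → X → A → ℝ} {sel : (X → A → ℝ) → X → A} {δ : ℝ}

/-- A reward of the class as an element of `ℓ^∞` of the support graph. -/
noncomputable def rewLp (hC : CompactContinuous d₀ π₀ R) (q : P) :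
    lp (fun _ : supportGraph π₀ => ℝ) ∞ :=
  ⟨onSupport π₀ (R q), hC.bounded q⟩

theorem rewLp_mem (hC : CompactContinuous d₀ π₀ R) (q : P) : rewLp hC q ∈ rewardClass π₀ R :=
  ⟨q, rfl⟩

theorem exists_eq_rewLp (hC : CompactContinuous d₀ π₀ R) {f : lp (fun _ : supportGraph π₀ => ℝ) ∞}
    (hf : f ∈ rewardClass π₀ R) : ∃ q, f = rewLp hC q := by
  obtain ⟨q, hq⟩ := hf
  exact ⟨q, lp.ext hq⟩

theorem abs_sub_le_dist (hC : CompactContinuous d₀ π₀ R) (q q' : P) {x : X} {a : A}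
    (ha : a ∈ (π₀ x).support) : |R q x a - R q' x a| ≤ dist (rewLp hC q) (rewLp hC q') := by
  rw [dist_eq_norm]
  exact lp.norm_apply_le_norm ENNReal.top_ne_zero (rewLp hC q - rewLp hC q') ⟨(x, a), ha⟩

theorem abs_le_envelope (hC : CompactContinuous d₀ π₀ R) (q : P) {x : X} {a : A}
    (ha : a ∈ (π₀ x).support) : |R q x a| ≤ envelope π₀ R := by
  refine (lp.norm_apply_le_norm ENNReal.top_ne_zero (rewLp hC q) ⟨(x, a), ha⟩).trans ?_
  obtain ⟨C, hC'⟩ := hC.compact.isBounded.exists_norm_le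
  refine le_csSup ⟨C, ?_⟩ ⟨_, rewLp_mem hC q, rfl⟩
  rintro _ ⟨f, hf, rfl⟩
  exact hC' f hf

theorem envelope_nonneg (π₀ : Kernel X A) (R : P → X → A → ℝ) : 0 ≤ envelope π₀ R :=
  Real.sSup_nonneg (by rintro _ ⟨f, _, rfl⟩; exact norm_nonneg f)

namespace Standing

variable (h : Standing d₀ π₀ R sel δ)
include h

theorem measurable_apply (p : P) (x : X) : Measurable (R p x) :=
  (h.measurable p).comp measurable_prodMk_left

theorem le_maxGap (p : P) {x : X} {a : A} (ha : a ∈ (π₀ x).support) :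
    R p x (sel (R p) x) - R p x a ≤ maxGap π₀ R sel := by
  refine le_csSup ⟨2 * envelope π₀ R, ?_⟩ ⟨p, x, a, ha, rfl⟩
  rintro _ ⟨q, y, b, hb, rfl⟩
  have h1 := (abs_le.1 (abs_le_envelope h.compactContinuous q hb)).1
  have h2 := (abs_le.1 (abs_le_envelope h.compactContinuous q
    ((h.selector q).mem_support y))).2
  linarith

theorem maxGap_nonneg : 0 ≤ maxGap π₀ R sel :=
  Real.sSup_nonneg (by
    rintro _ ⟨p, x, a, ha, rfl⟩
    exact sub_nonneg.2 ((h.selector p).isMax x a ha))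

theorem sel_ae_eq_of_dist_lt {q q' : P}
    (hd : dist (rewLp h.compactContinuous q) (rewLp h.compactContinuous q') < δ) :
    sel (R q) =ᵐ[d₀] sel (R q') := by
  filter_upwards [h.gap q, h.gap q'] with x hx hx'
  by_contra hne
  have hs := (h.selector q).mem_support x
  have hs' := (h.selector q').mem_support x
  have h1 := hx _ hs' (Ne.symm hne)
  have h2 := hx' _ hs hne
  have h3 := (abs_le.1 (abs_sub_le_dist h.compactContinuous q q' hs)).2
  have h4 := (abs_le.1 (abs_sub_le_dist h.compactContinuous q q' hs')).1
  linarith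

/-- By compactness and the uniform gap, the class induces only finitely many selectors up to
almost sure equality. -/
theorem exists_finset_sel : ∃ s : Finset P, ∀ q, ∃ i ∈ s, sel (R q) =ᵐ[d₀] sel (R i) := by
  classical
  rcases isEmpty_or_nonempty P with hP | hP
  · exact ⟨∅, fun q => isEmptyElim q⟩
  obtain ⟨t, hts, htf, ht⟩ := h.compactContinuous.compact.finite_cover_balls h.pos
  choose! g hg using fun f (hf : f ∈ t) => exists_eq_rewLp h.compactContinuous (hts hf)
  refine ⟨htf.toFinset.image g, fun q => ?_⟩
  obtain ⟨f, hf, hqf⟩ := Set.mem_iUnion₂.1 (ht (rewLp_mem h.compactContinuous q))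
  refine ⟨g f, Finset.mem_image_of_mem _ (htf.mem_toFinset.2 hf), h.sel_ae_eq_of_dist_lt ?_⟩
  rw [← hg f hf]
  exact hqf

theorem sel_ae_eq_of_ae_le {p q : P}
    (hle : ∀ᵐ x ∂d₀, R p x (sel (R p) x) ≤ R p x (sel (R q) x)) :
    sel (R p) =ᵐ[d₀] sel (R q) := by
  filter_upwards [h.gap p, hle] with x hx hle
  by_contra hne
  linarith [hx _ ((h.selector q).mem_support x) (Ne.symm hne), h.pos]

theorem integrable_regret [IsFiniteMeasure d₀] (p : P) {a : X → A} (ha : Measurable a)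
    (hs : ∀ x, a x ∈ (π₀ x).support) :
    Integrable (fun x => R p x (sel (R p) x) - R p x (a x)) d₀ := by
  refine Integrable.of_bound (C := maxGap π₀ R sel) ?_ (ae_of_all _ fun x => ?_)
  · exact (((h.measurable p).comp (measurable_id.prodMk (h.selector p).measurable)).sub
      ((h.measurable p).comp (measurable_id.prodMk ha))).aestronglyMeasurable
  · rw [Real.norm_of_nonneg (sub_nonneg.2 ((h.selector p).isMax x _ (hs x)))]
    exact h.le_maxGap p (hs x)

theorem recommendationRegret_le [IsProbabilityMeasure d₀] (p : P) {a : X → A} (ha : Measurable a)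
    (hs : ∀ x, a x ∈ (π₀ x).support) :
    recommendationRegret d₀ (R p) (sel (R p)) a ≤ maxGap π₀ R sel := by
  refine (integral_mono (h.integrable_regret p ha hs) (integrable_const (maxGap π₀ R sel))
    fun x => h.le_maxGap p (hs x)).trans_eq ?_
  simp

theorem regret_nonneg (p q : P) : 0 ≤ regret d₀ sel (R p) (R q) :=
  integral_nonneg fun x => sub_nonneg.2
    ((h.selector p).isMax x _ ((h.selector q).mem_support x))

omit h [MeasurableSpace A] [MetricSpace A] in
theorem recommendationRegret_congr (Rstar : X → A → ℝ) (b : X → A) {a a' : X → A}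
    (ha : a =ᵐ[d₀] a') :
    recommendationRegret d₀ Rstar b a = recommendationRegret d₀ Rstar b a' := by
  refine integral_congr_ae ?_
  filter_upwards [ha] with x hx
  rw [hx]

omit h [MeasurableSpace A] [MetricSpace A] in
theorem regret_eq_zero_of_sel_ae_eq {p q : P} (hpq : sel (R p) =ᵐ[d₀] sel (R q)) :
    regret d₀ sel (R p) (R q) = 0 := by
  rw [regret, recommendationRegret_congr _ _ hpq.symm]
  simp [recommendationRegret]

section SecondCountable

variable [SecondCountableTopology A]

theorem ae_abs_le (q : P) (x : X) : ∀ᵐ a ∂(π₀ x), |R q x a| ≤ envelope π₀ R := by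
  filter_upwards [Measure.support_mem_ae (μ := π₀ x)] with a ha
  exact abs_le_envelope h.compactContinuous q ha

theorem sel_ae_eq_of_ae_ae_eq {p q : P} (hpq : ∀ᵐ x ∂d₀, R p x =ᵐ[π₀ x] R q x) :
    sel (R p) =ᵐ[d₀] sel (R q) := by
  refine h.sel_ae_eq_of_ae_le ?_
  filter_upwards [hpq, h.compactContinuous.continuousOn p,
    h.compactContinuous.continuousOn q] with x hx hp hq
  have he := eqOn_support_of_ae_eq Measure.support_mem_ae hp hq hx
  rw [he ((h.selector p).mem_support x), he ((h.selector q).mem_support x)]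
  exact (h.selector q).isMax x _ ((h.selector p).mem_support x)

theorem sel_zero_ae_eq {q : P} (hq : ∀ᵐ x ∂d₀, R q x =ᵐ[π₀ x] 0) :
    sel 0 =ᵐ[d₀] sel (R q) := by
  filter_upwards [hq, h.compactContinuous.continuousOn q, h.gap q] with x hx hc hgap
  have he := eqOn_support_of_ae_eq Measure.support_mem_ae hc
    (continuousOn_const (c := (0 : ℝ))) hx
  by_contra hne
  have := hgap _ (h.selector_zero.mem_support x) hne
  rw [he (h.selector_zero.mem_support x), he ((h.selector q).mem_support x)] at this
  linarith [h.pos]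

theorem ae_measure_singleton_sel_pos (q : P) : ∀ᵐ x ∂d₀, 0 < π₀ x {sel (R q) x} := by
  filter_upwards [h.compactContinuous.continuousOn q, h.gap q] with x hc hgap
  exact measure_singleton_pos_of_gap Measure.support_mem_ae hc ((h.selector q).mem_support x)
    h.pos hgap

variable [BorelSpace A]

/-- The regret is at least the gap times the probability of recommending a different action. -/
theorem mul_measure_ne_le_regret [IsFiniteMeasure d₀] (p q : P) :
    δ * d₀.real {x | sel (R p) x ≠ sel (R q) x} ≤ regret d₀ sel (R p) (R q) := by
  have hm : MeasurableSet {x | sel (R p) x ≠ sel (R q) x} :=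
    (measurableSet_eq_fun (h.selector p).measurable (h.selector q).measurable).compl
  have h1 : ∫ x, Set.indicator {x | sel (R p) x ≠ sel (R q) x} (fun _ => δ) x ∂d₀ =
      δ * d₀.real {x | sel (R p) x ≠ sel (R q) x} := by
    rw [integral_indicator_const _ hm, smul_eq_mul, mul_comm]
  rw [← h1]
  refine integral_mono_ae ((integrable_const δ).indicator hm)
    (h.integrable_regret p (h.selector q).measurable (h.selector q).mem_support) ?_
  filter_upwards [h.gap p] with x hx
  by_cases hxe : sel (R p) x = sel (R q) x
  · rw [Set.indicator_of_notMem (by simpa using hxe), hxe, sub_self]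
  · rw [Set.indicator_of_mem (by simpa using hxe)]
    linarith [hx _ ((h.selector q).mem_support x) (Ne.symm hxe)]

/-- Only finitely many disagreement probabilities occur; the smallest positive one, times the
gap, isolates the positive regrets from zero. -/
theorem exists_isolatesRegret [IsFiniteMeasure d₀] : ∃ ε, IsolatesRegret d₀ R sel ε := by
  classical
  obtain ⟨s, hs⟩ := h.exists_finset_sel
  let D : P → P → ℝ := fun p q => d₀.real {x | sel (R p) x ≠ sel (R q) x}
  obtain ⟨m, hm0, hm⟩ : ∃ m > 0, ∀ i ∈ s, ∀ j ∈ s, 0 < D i j → m ≤ D i j := by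
    let S := ((s ×ˢ s).image fun z : P × P => D z.1 z.2).filter (0 < ·)
    have hS' : ∀ i ∈ s, ∀ j ∈ s, 0 < D i j → D i j ∈ S := fun i hi j hj hij =>
      Finset.mem_filter.2 ⟨Finset.mem_image_of_mem (fun z : P × P => D z.1 z.2)
        (Finset.mk_mem_product hi hj), hij⟩
    rcases S.eq_empty_or_nonempty with hS | hS
    · refine ⟨1, one_pos, fun i hi j hj hij => absurd (hS' i hi j hj hij) ?_⟩
      exact Finset.eq_empty_iff_forall_notMem.1 hS (D i j)
    · refine ⟨S.min' hS, (Finset.mem_filter.1 (S.min'_mem hS)).2, fun i hi j hj hij =>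
        S.min'_le _ (hS' i hi j hj hij)⟩
  refine ⟨δ * m, mul_pos h.pos hm0, fun p q => ?_⟩
  by_cases hpq : sel (R p) =ᵐ[d₀] sel (R q)
  · exact Or.inl (regret_eq_zero_of_sel_ae_eq hpq)
  · right
    obtain ⟨i, hi, hpi⟩ := hs p
    obtain ⟨j, hj, hqj⟩ := hs q
    have hD : D p q = D i j := by
      refine measureReal_congr ?_
      filter_upwards [hpi, hqj] with x h1 h2
      simp only [eq_iff_iff]
      change (sel (R p) x ≠ sel (R q) x) ↔ (sel (R i) x ≠ sel (R j) x)
      rw [h1, h2]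
    have hpos : 0 < D p q := by
      refine measureReal_nonneg.lt_of_ne' fun h0 => hpq ?_
      rw [measureReal_eq_zero_iff] at h0
      exact h0
    rw [hD] at hpos
    exact (mul_le_mul_of_nonneg_left ((hm i hi j hj hpos).trans_eq hD.symm) h.pos.le).trans
      (h.mul_measure_ne_le_regret p q)

end SecondCountable

end Standing

end Model

/-! ### Tilted measures -/

section Tilted

variable {A : Type*} [MeasurableSpace A] {μ : Measure A} [IsProbabilityMeasure μ] {f g : A → ℝ}

theorem ae_eq_of_ae_sub_eq_const (hf : Integrable f μ) (hg : Integrable g μ)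
    (hfg : ∫ a, f a ∂μ = ∫ a, g a ∂μ) {c : ℝ} (hc : ∀ᵐ a ∂μ, f a - g a = c) : f =ᵐ[μ] g := by
  have h := integral_congr_ae hc
  rw [integral_sub hf hg, hfg, sub_self] at h
  simp only [integral_const, probReal_univ, smul_eq_mul, one_mul] at h
  filter_upwards [hc] with a ha
  linarith

/-- Exponential tilting is injective on centered exponents. -/
theorem ae_eq_of_tilted_eq {η : ℝ} (hη : 0 < η) (hf : Integrable f μ) (hg : Integrable g μ)
    (hfg : ∫ a, f a ∂μ = ∫ a, g a ∂μ) (hef : Integrable (fun a => Real.exp (η * f a)) μ)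
    (heg : Integrable (fun a => Real.exp (η * g a)) μ)
    (h : (μ.tilted fun a => η * f a) = μ.tilted fun a => η * g a) : f =ᵐ[μ] g := by
  have h1 := rnDeriv_tilted_left_self (μ := μ) (hf.1.aemeasurable.const_mul η)
  have h2 := rnDeriv_tilted_left_self (μ := μ) (hg.1.aemeasurable.const_mul η)
  rw [h] at h1
  have hZf := integral_exp_pos hef
  have hZg := integral_exp_pos heg
  refine ae_eq_of_ae_sub_eq_const hf hg hfg
    (c := (Real.log (∫ a, Real.exp (η * f a) ∂μ) - Real.log (∫ a, Real.exp (η * g a) ∂μ)) / η) ?_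
  filter_upwards [h1, h2] with a h1 h2
  rw [h1, ENNReal.ofReal_eq_ofReal_iff (by positivity) (by positivity)] at h2
  have h3 := congrArg Real.log h2
  rw [Real.log_div (Real.exp_pos _).ne' hZf.ne', Real.log_div (Real.exp_pos _).ne' hZg.ne',
    Real.log_exp, Real.log_exp] at h3
  rw [eq_div_iff hη.ne']
  linarith

theorem exp_neg_smul_le_tilted {C : ℝ} (hf : Measurable f) (hC : ∀ᵐ a ∂μ, |f a| ≤ C) :
    ENNReal.ofReal (Real.exp (-(2 * C))) • μ ≤ μ.tilted f := by
  have hint : Integrable (fun a => Real.exp (f a)) μ := by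
    refine Integrable.of_bound (C := Real.exp C)
      (Real.measurable_exp.comp hf).aestronglyMeasurable ?_
    filter_upwards [hC] with a ha
    rw [Real.norm_of_nonneg (Real.exp_pos _).le, Real.exp_le_exp]
    exact (abs_le.1 ha).2
  have hZ : ∫ a, Real.exp (f a) ∂μ ≤ Real.exp C := by
    refine (integral_mono_ae hint (integrable_const (Real.exp C)) ?_).trans_eq (by simp)
    filter_upwards [hC] with a ha
    exact Real.exp_le_exp.2 (abs_le.1 ha).2
  refine Measure.le_iff.2 fun s hs => ?_
  rw [tilted_apply' _ _ hs, Measure.smul_apply, smul_eq_mul, ← setLIntegral_const]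
  refine lintegral_mono_ae (ae_restrict_of_ae ?_)
  filter_upwards [hC] with a ha
  refine ENNReal.ofReal_le_ofReal ?_
  rw [le_div_iff₀ (integral_exp_pos hint)]
  refine (mul_le_mul_of_nonneg_left hZ (Real.exp_pos _).le).trans ?_
  rw [← Real.exp_add, Real.exp_le_exp]
  linarith [(abs_le.1 ha).1]

end Tilted

namespace Standing

section

variable {X A P : Type*} [MeasurableSpace X] [MetricSpace A] [MeasurableSpace A]
  [SecondCountableTopology A]
  {d₀ : Measure X} {π₀ : Kernel X A} [IsMarkovKernel π₀] {R : P → X → A → ℝ}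
  {sel : (X → A → ℝ) → X → A} {δ η : ℝ} (h : Standing d₀ π₀ R sel δ)
include h

omit [IsMarkovKernel π₀] in
theorem ae_abs_mul_le (hη : 0 < η) (q : P) (x : X) :
    ∀ᵐ a ∂(π₀ x), |η * R q x a| ≤ η * envelope π₀ R := by
  filter_upwards [h.ae_abs_le q x] with a ha
  rw [abs_mul, abs_of_pos hη]
  exact mul_le_mul_of_nonneg_left ha hη.le

theorem integrable_exp (hη : 0 < η) (q : P) (x : X) :
    Integrable (fun a => Real.exp (η * R q x a)) (π₀ x) := by
  refine Integrable.of_bound (C := Real.exp (η * envelope π₀ R))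
    (Real.measurable_exp.comp ((h.measurable_apply q x).const_mul η)).aestronglyMeasurable ?_
  filter_upwards [h.ae_abs_mul_le hη q x] with a ha
  rw [Real.norm_of_nonneg (Real.exp_pos _).le, Real.exp_le_exp]
  exact (abs_le.1 ha).2

theorem ae_eq_of_tiltedPolicy_eq (hη : 0 < η) {p q : P}
    (hpq : tiltedPolicy π₀ η (R p) = tiltedPolicy π₀ η (R q)) (x : X) : R p x =ᵐ[π₀ x] R q x :=
  ae_eq_of_tilted_eq hη (h.centered p x).1 (h.centered q x).1
    ((h.centered p x).2.trans (h.centered q x).2.symm) (h.integrable_exp hη p x)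
    (h.integrable_exp hη q x) (congrFun hpq x)

theorem sel_ae_eq_of_tiltedPolicy_eq (hη : 0 < η) {p q : P}
    (hpq : tiltedPolicy π₀ η (R p) = tiltedPolicy π₀ η (R q)) : sel (R p) =ᵐ[d₀] sel (R q) :=
  h.sel_ae_eq_of_ae_ae_eq (ae_of_all _ (h.ae_eq_of_tiltedPolicy_eq hη hpq))

theorem sel_zero_ae_eq_of_tiltedPolicy_eq (hη : 0 < η) {q : P}
    (hq : tiltedPolicy π₀ η (R q) = fun x => π₀ x) : sel 0 =ᵐ[d₀] sel (R q) := by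
  refine h.sel_zero_ae_eq (ae_of_all _ fun x => ?_)
  refine ae_eq_of_tilted_eq hη (g := 0) (h.centered q x).1 (integrable_zero _ _ _) ?_
    (h.integrable_exp hη q x) (by simp) ?_
  · simp [(h.centered q x).2]
  · have := congrFun hq x
    rw [tiltedPolicy] at this
    simp [this]

/-- On a policy induced by `R q`, the recommendation is almost surely the selector of `R q`, even
if this policy coincides with the reference policy. -/
theorem policySelector_ae_eq (hη : 0 < η) {rew : (X → Measure A) → X → A → ℝ}
    (hrew : IsInducingReward π₀ η R rew) {π : X → Measure A} {q : P}
    (hq : π = tiltedPolicy π₀ η (R q)) : policySelector π₀ sel rew π =ᵐ[d₀] sel (R q) := by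
  unfold policySelector
  split_ifs with h0
  · exact h.sel_zero_ae_eq_of_tiltedPolicy_eq hη (hq.symm.trans h0)
  · obtain ⟨q', hq', hπ⟩ := hrew π ⟨q, hq⟩
    rw [hq']
    exact h.sel_ae_eq_of_tiltedPolicy_eq hη (hπ.symm.trans hq)

theorem policyRegret_eq (hη : 0 < η) {rew : (X → Measure A) → X → A → ℝ}
    (hrew : IsInducingReward π₀ η R rew) {π : X → Measure A} {q : P}
    (hq : π = tiltedPolicy π₀ η (R q)) (p : P) :
    policyRegret d₀ π₀ sel rew (R p) π = regret d₀ sel (R p) (R q) :=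
  recommendationRegret_congr _ _ (h.policySelector_ae_eq hη hrew hq)

theorem smul_le_tiltedPolicy (hη : 0 < η) (q : P) (x : X) :
    ENNReal.ofReal (Real.exp (2 * η * envelope π₀ R))⁻¹ • π₀ x ≤ tiltedPolicy π₀ η (R q) x := by
  have := exp_neg_smul_le_tilted ((h.measurable_apply q x).const_mul η) (h.ae_abs_mul_le hη q x)
  rwa [Real.exp_neg, ← mul_assoc] at this

/-- The implicit reward difference of a tilted policy: the normalizing constant cancels. -/
theorem log_tiltDensity_sub (hη : 0 < η) (q : P) (x : X) (a b : A) :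
    1 / η * (Real.log (tiltDensity π₀ η (R q) x a) - Real.log (tiltDensity π₀ η (R q) x b)) =
      R q x a - R q x b := by
  have hZ := (integral_exp_pos (h.integrable_exp hη q x)).ne'
  rw [tiltDensity, tiltDensity, Real.log_div (Real.exp_pos _).ne' hZ,
    Real.log_div (Real.exp_pos _).ne' hZ, Real.log_exp, Real.log_exp]
  field_simp
  ring

/-- The DPO empirical loss of a policy is the empirical log-loss of its reward. -/
theorem dpoLoss_eq (hη : 0 < η) {rew : (X → Measure A) → X → A → ℝ} {π : X → Measure A} {q : P}
    (hq : rew π = R q) {t : ℕ} (y : Fin t → Obs X A) :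
    dpoLoss π₀ η rew y π =
      1 / (t : ℝ) * ∑ s, logLoss (fun l => R q (y s).1 ((y s).2.1 l)) (y s).2.2 := by
  unfold dpoLoss
  congr 1
  refine Finset.sum_congr rfl fun s _ => ?_
  rw [hq, ← neg_log_sigmoid_sub]
  simp only [h.log_tiltDensity_sub hη]

end

end Standing

/-! ### Slates of two independent actions -/

section Slate

variable {X A : Type*} [MeasurableSpace X] [MeasurableSpace A]

/-- The kernel of slates of two independent actions drawn from `κ`. -/
noncomputable def pairKernel (κ : Kernel X A) : Kernel X (Fin 2 → A) :=
  (κ ×ₖ κ).map (MeasurableEquiv.piFinTwo fun _ => A).symm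

theorem pairKernel_apply (κ : Kernel X A) [IsMarkovKernel κ] (x : X) :
    pairKernel κ x = Measure.pi fun _ => κ x := by
  rw [pairKernel, Kernel.map_apply _ (MeasurableEquiv.measurable _), Kernel.prod_apply]
  exact (measurePreserving_piFinTwo fun _ => κ x).symm.map_eq

instance (κ : Kernel X A) [IsMarkovKernel κ] : IsMarkovKernel (pairKernel κ) :=
  ⟨fun x => by rw [pairKernel_apply]; infer_instance⟩

/-- The joint law of a context and a slate of two independent actions drawn from `κ`. -/
noncomputable def slateMeasure (d₀ : Measure X) (κ : Kernel X A) : Measure (X × (Fin 2 → A)) :=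
  d₀ ⊗ₘ pairKernel κ

variable {d₀ : Measure X} [IsProbabilityMeasure d₀] {κ κ' : Kernel X A} [IsMarkovKernel κ]
  [IsMarkovKernel κ']

instance : IsProbabilityMeasure (slateMeasure d₀ κ) := by
  unfold slateMeasure; infer_instance

theorem lintegral_slateMeasure {f : X × (Fin 2 → A) → ℝ≥0∞} (hf : Measurable f) :
    ∫⁻ z, f z ∂slateMeasure d₀ κ = ∫⁻ x, ∫⁻ a, f (x, a) ∂(Measure.pi fun _ => κ x) ∂d₀ := by
  rw [slateMeasure, Measure.lintegral_compProd hf]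
  simp_rw [pairKernel_apply]

theorem integral_slateMeasure {f : X × (Fin 2 → A) → ℝ} (hf : Integrable f (slateMeasure d₀ κ)) :
    ∫ z, f z ∂slateMeasure d₀ κ = ∫ x, ∫ a, f (x, a) ∂(Measure.pi fun _ => κ x) ∂d₀ := by
  rw [slateMeasure, Measure.integral_compProd hf]
  simp_rw [pairKernel_apply]

theorem ae_slateMeasure {S : Set (X × A)} (hS : MeasurableSet S)
    (h : ∀ x, ∀ᵐ a ∂(κ x), (x, a) ∈ S) :
    ∀ᵐ z ∂slateMeasure d₀ κ, ∀ k, (z.1, z.2 k) ∈ S := by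
  have hm : MeasurableSet {z : X × (Fin 2 → A) | ∀ k, (z.1, z.2 k) ∈ S} := by
    simp only [Set.ofPred_forall]
    exact MeasurableSet.iInter fun k =>
      (measurable_fst.prodMk ((measurable_pi_apply k).comp measurable_snd)) hS
  rw [slateMeasure, Measure.ae_compProd_iff hm]
  refine ae_of_all _ fun x => ?_
  rw [pairKernel_apply, ae_all_iff]
  exact fun k => (Measure.quasiMeasurePreserving_eval (fun _ => κ x) k).ae (h x)

theorem smul_slateMeasure_le {c : ℝ≥0∞} (h : ∀ x, c • κ x ≤ κ' x) :
    (c ^ 2) • slateMeasure d₀ κ ≤ slateMeasure d₀ κ' := by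
  refine Measure.le_iff.2 fun s hs => ?_
  rw [Measure.smul_apply, slateMeasure, slateMeasure, Measure.compProd_apply hs,
    Measure.compProd_apply hs, smul_eq_mul,
    ← lintegral_const_mul _ (Kernel.measurable_kernel_prodMk_left hs)]
  refine lintegral_mono fun x => ?_
  have hx : (c ^ 2) • ((κ x).prod (κ x)) ≤ (κ' x).prod (κ' x) := by
    refine Measure.le_iff.2 fun t ht => ?_
    rw [Measure.smul_apply, Measure.prod_apply ht, Measure.prod_apply ht, smul_eq_mul, sq,
      mul_assoc, ← lintegral_const_mul _ (measurable_measure_prodMk_left ht)]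
    calc c * ∫⁻ a, c * κ x (Prod.mk a ⁻¹' t) ∂(κ x)
        = ∫⁻ a, c * κ x (Prod.mk a ⁻¹' t) ∂(c • κ x) := by rw [lintegral_smul_measure, smul_eq_mul]
      _ ≤ ∫⁻ a, κ' x (Prod.mk a ⁻¹' t) ∂(κ' x) :=
          lintegral_mono' (h x) fun a => h x _
  have hmt := (MeasurableEquiv.piFinTwo fun _ : Fin 2 => A).symm.measurable
  have ht : MeasurableSet (Prod.mk x ⁻¹' s) := measurable_prodMk_left hs
  rw [pairKernel, pairKernel, Kernel.map_apply' _ hmt _ ht, Kernel.map_apply' _ hmt _ ht,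
    Kernel.prod_apply, Kernel.prod_apply]
  exact hx _

end Slate

/-! ### The population-loss gap -/

/-- The values that a reward gives to the actions of a slate. -/
def score {X A : Type*} {K : ℕ} (R : X → A → ℝ) (z : X × (Fin K → A)) : Fin K → ℝ :=
  fun l => R z.1 (z.2 l)

section Score

variable {X A : Type*} [MeasurableSpace X] [MeasurableSpace A] {K : ℕ}

theorem measurable_score {R : X → A → ℝ} (hR : Measurable (Function.uncurry R)) (l : Fin K) :
    Measurable fun z : X × (Fin K → A) => score R z l :=
  hR.comp (measurable_fst.prodMk ((measurable_pi_apply l).comp measurable_snd))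

theorem measurable_logLoss_score {R : X → A → ℝ} (hR : Measurable (Function.uncurry R))
    (k : Fin K) : Measurable fun z : X × (Fin K → A) => logLoss (score R z) k :=
  (Real.measurable_log.comp (Finset.measurable_sum _ fun l _ =>
    Real.measurable_exp.comp (measurable_score hR l))).sub (measurable_score hR k)

theorem measurable_excessLoss_score {R R' : X → A → ℝ} (hR : Measurable (Function.uncurry R))
    (hR' : Measurable (Function.uncurry R')) :
    Measurable fun z : X × (Fin K → A) => excessLoss (score R z) (score R' z) :=
  Finset.measurable_sum _ fun k _ =>
    (Real.measurable_exp.comp (measurable_logLoss_score hR k).neg).mul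
      ((measurable_logLoss_score hR' k).sub (measurable_logLoss_score hR k))

end Score

namespace Standing

variable {X A P : Type*} [MeasurableSpace X] [MetricSpace A] [MeasurableSpace A]
  [SecondCountableTopology A] [BorelSpace A]
  {d₀ : Measure X} [IsProbabilityMeasure d₀] {π₀ : Kernel X A} [IsMarkovKernel π₀]
  {R : P → X → A → ℝ} {sel : (X → A → ℝ) → X → A} {δ : ℝ} (h : Standing d₀ π₀ R sel δ)

omit [IsMarkovKernel π₀] in
theorem ae_mem_supportGraph {κ : Kernel X A} [IsMarkovKernel κ] (hκ : ∀ x, κ x ≪ π₀ x) :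
    ∀ᵐ z ∂slateMeasure d₀ κ, ∀ k, (z.1, z.2 k) ∈ supportGraph π₀ :=
  ae_slateMeasure (measurableSet_supportGraph π₀) fun x => (hκ x).ae_le Measure.support_mem_ae

include h

omit [SecondCountableTopology A] [BorelSpace A] [IsProbabilityMeasure d₀] [IsMarkovKernel π₀] in
theorem abs_score_le (q : P) {K : ℕ} {z : X × (Fin K → A)}
    (hz : ∀ k, (z.1, z.2 k) ∈ supportGraph π₀) (k : Fin K) : |score (R q) z k| ≤ envelope π₀ R :=
  abs_le_envelope h.compactContinuous q (hz k)

omit [IsMarkovKernel π₀] in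
theorem integrable_excessLoss {κ : Kernel X A} [IsMarkovKernel κ] (hκ : ∀ x, κ x ≪ π₀ x) (p q : P) :
    Integrable (fun z => excessLoss (score (R p) z) (score (R q) z)) (slateMeasure d₀ κ) := by
  refine Integrable.of_bound (C := Real.log (2 : ℕ) + 2 * envelope π₀ R)
    (measurable_excessLoss_score (h.measurable p) (h.measurable q)).aestronglyMeasurable ?_
  filter_upwards [ae_mem_supportGraph hκ] with z hz
  rw [Real.norm_of_nonneg (excessLoss_nonneg _ _)]
  exact excessLoss_le (h.abs_score_le p hz) (h.abs_score_le q hz)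

theorem integrable_crossLoss (p q : P) :
    Integrable (fun z => ∑ k, Real.exp (-logLoss (score (R p) z) k) * logLoss (score (R q) z) k)
      (slateMeasure d₀ π₀) := by
  refine Integrable.of_bound (C := Real.log (2 : ℕ) + 2 * envelope π₀ R)
    (Finset.measurable_sum _ fun k _ =>
      (Real.measurable_exp.comp (measurable_logLoss_score (h.measurable p) k).neg).mul
        (measurable_logLoss_score (h.measurable q) k)).aestronglyMeasurable ?_
  filter_upwards [ae_mem_supportGraph fun x => Measure.AbsolutelyContinuous.rfl] with z hz
  rw [Real.norm_of_nonneg (Finset.sum_nonneg fun k _ =>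
    mul_nonneg (Real.exp_pos _).le (logLoss_nonneg _ _))]
  calc _ ≤ ∑ k, Real.exp (-logLoss (score (R p) z) k) *
        (Real.log (2 : ℕ) + 2 * envelope π₀ R) :=
        Finset.sum_le_sum fun k _ => mul_le_mul_of_nonneg_left
          (logLoss_le (h.abs_score_le q hz) k) (Real.exp_pos _).le
    _ = _ := by rw [← Finset.sum_mul, sum_exp_neg_logLoss, one_mul]

theorem populationLoss_eq (p q : P) :
    populationLoss 2 d₀ π₀ (R p) (R q) =
      ∫ z, ∑ k, Real.exp (-logLoss (score (R p) z) k) * logLoss (score (R q) z) k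
        ∂slateMeasure d₀ π₀ := by
  rw [integral_slateMeasure (h.integrable_crossLoss p q), populationLoss]
  simp_rw [choiceProb_eq_exp_neg_logLoss]
  rfl

theorem populationLoss_sub (p q : P) :
    populationLoss 2 d₀ π₀ (R p) (R q) - populationLoss 2 d₀ π₀ (R p) (R p) =
      ∫ z, excessLoss (score (R p) z) (score (R q) z) ∂slateMeasure d₀ π₀ := by
  rw [h.populationLoss_eq, h.populationLoss_eq,
    ← integral_sub (h.integrable_crossLoss p q) (h.integrable_crossLoss p p)]
  simp only [excessLoss, mul_sub, Finset.sum_sub_distrib]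

/-- Rewards that are indistinguishable in population log-loss have the same selector: the choice
probabilities determine a reward up to a function of the context, which centering fixes. -/
theorem sel_ae_eq_of_integral_excessLoss_eq_zero {p q : P}
    (h0 : ∫ z, excessLoss (score (R p) z) (score (R q) z) ∂slateMeasure d₀ π₀ = 0) :
    sel (R p) =ᵐ[d₀] sel (R q) := by
  rw [integral_eq_zero_iff_of_nonneg (fun z => excessLoss_nonneg _ _)
    (h.integrable_excessLoss (fun x => Measure.AbsolutelyContinuous.rfl) p q)] at h0
  have hm := measurable_excessLoss_score (K := 2) (h.measurable p) (h.measurable q)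
  have h1 := (Measure.ae_compProd_iff (hm (measurableSet_singleton 0))).1 h0
  refine h.sel_ae_eq_of_ae_ae_eq ?_
  filter_upwards [h1] with x hx
  rw [pairKernel_apply] at hx
  have h2 := Measure.ae_ae_of_ae_prod
    ((measurePreserving_piFinTwo fun _ => π₀ x).symm.quasiMeasurePreserving.ae hx)
  obtain ⟨a, ha⟩ := h2.exists
  refine ae_eq_of_ae_sub_eq_const (h.centered p x).1 (h.centered q x).1
    ((h.centered p x).2.trans (h.centered q x).2.symm) (c := R p x a - R q x a) ?_
  filter_upwards [ha] with b hb
  have := sub_eq_sub_of_excessLoss_eq_zero hb 0 1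
  change R p x a - R p x b = R q x a - R q x b at this
  linarith

theorem abs_integral_excessLoss_sub_le {p q p' q' : P} {r : ℝ}
    (hp : dist (rewLp h.compactContinuous p) (rewLp h.compactContinuous p') ≤ r)
    (hq : dist (rewLp h.compactContinuous q) (rewLp h.compactContinuous q') ≤ r) :
    |∫ z, excessLoss (score (R p) z) (score (R q) z) ∂slateMeasure d₀ π₀ -
      ∫ z, excessLoss (score (R p') z) (score (R q') z) ∂slateMeasure d₀ π₀| ≤
      4 * ((2 : ℕ) * (Real.log (2 : ℕ) + 2 * envelope π₀ R) + 1) * r := by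
  have hac : ∀ x, π₀ x ≪ π₀ x := fun x => Measure.AbsolutelyContinuous.rfl
  rw [← integral_sub (h.integrable_excessLoss hac p q) (h.integrable_excessLoss hac p' q'),
    ← Real.norm_eq_abs]
  refine (norm_integral_le_of_norm_le_const (C :=
    4 * ((2 : ℕ) * (Real.log (2 : ℕ) + 2 * envelope π₀ R) + 1) * r) ?_).trans_eq (by simp)
  filter_upwards [ae_mem_supportGraph hac] with z hz
  exact abs_excessLoss_sub_le (h.abs_score_le p hz) (h.abs_score_le q hz)
    (fun l => (abs_sub_le_dist h.compactContinuous p p' (hz l)).trans hp)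
    (fun l => (abs_sub_le_dist h.compactContinuous q q' (hz l)).trans hq)

/-- The excess loss is continuous and the selectors are locally constant on the compact class, so
positive regret forces a uniformly positive excess loss. -/
theorem exists_isLossGap {ε : ℝ} (hε : 0 < ε) : ∃ γ, IsLossGap 2 d₀ π₀ R sel ε γ := by
  have hC := h.compactContinuous
  let I : P → P → ℝ := fun p q =>
    ∫ z, excessLoss (score (R p) z) (score (R q) z) ∂slateMeasure d₀ π₀
  have key := (hC.compact.prod hC.compact).induction_on (p := fun S => ∃ γ, 0 < γ ∧ ∀ p q,
      (rewLp hC p, rewLp hC q) ∈ S → ε ≤ regret d₀ sel (R p) (R q) → γ ≤ I p q)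
    ⟨1, one_pos, fun p q hpq => absurd hpq (Set.notMem_empty _)⟩
    (fun S T hST ⟨γ, hγ, hT⟩ => ⟨γ, hγ, fun p q hpq => hT p q (hST hpq)⟩)
    (fun S T ⟨γ, hγ, hS⟩ ⟨γ', hγ', hT⟩ => ⟨min γ γ', lt_min hγ hγ', fun p q hpq hr =>
      hpq.elim (fun hp => (min_le_left _ _).trans (hS p q hp hr))
        fun hp => (min_le_right _ _).trans (hT p q hp hr)⟩) ?_
  · obtain ⟨γ, hγ, hpq⟩ := key
    refine ⟨γ, hγ, fun p q hr => ?_⟩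
    rw [h.populationLoss_sub]
    exact hpq p q ⟨rewLp_mem hC p, rewLp_mem hC q⟩ hr
  · rintro ⟨f, g⟩ ⟨hf, hg⟩
    obtain ⟨p, rfl⟩ := exists_eq_rewLp hC hf
    obtain ⟨q, rfl⟩ := exists_eq_rewLp hC hg
    have hball : ∀ r > 0, Metric.ball (rewLp hC p) r ×ˢ Metric.ball (rewLp hC q) r ∈
        nhdsWithin (rewLp hC p, rewLp hC q) (rewardClass π₀ R ×ˢ rewardClass π₀ R) := fun r hr =>
      mem_nhdsWithin_of_mem_nhds (prod_mem_nhds (Metric.ball_mem_nhds _ hr)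
        (Metric.ball_mem_nhds _ hr))
    have hI : 0 ≤ I p q := integral_nonneg fun z => excessLoss_nonneg _ _
    rcases hI.eq_or_lt with h0 | h0
    · refine ⟨_, hball δ h.pos, 1, one_pos, fun p' q' hpq hr => ?_⟩
      have h1 := h.sel_ae_eq_of_dist_lt (Metric.mem_ball.1 hpq.1)
      have h2 := h.sel_ae_eq_of_dist_lt (Metric.mem_ball'.1 hpq.2)
      have h3 := h.sel_ae_eq_of_integral_excessLoss_eq_zero h0.symm
      linarith [regret_eq_zero_of_sel_ae_eq (R := R) ((h1.trans h3).trans h2)]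
    · set L : ℝ := 4 * ((2 : ℕ) * (Real.log (2 : ℕ) + 2 * envelope π₀ R) + 1) with hL
      have hLpos : 0 < L := by
        have := envelope_nonneg π₀ R
        have := Real.log_nonneg (x := ((2 : ℕ) : ℝ)) (by norm_num)
        positivity
      refine ⟨_, hball (I p q / (2 * L)) (by positivity), I p q / 2, by positivity,
        fun p' q' hpq _ => ?_⟩
      have h1 := (abs_le.1 (h.abs_integral_excessLoss_sub_le (Metric.mem_ball'.1 hpq.1).le
        (Metric.mem_ball'.1 hpq.2).le)).2
      rw [← hL] at h1
      have h2 : L * (I p q / (2 * L)) = I p q / 2 := by field_simp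
      rw [h2] at h1
      change I p q - I p' q' ≤ _ at h1
      linarith

end Standing

/-! ### Measurability of the regret of a fitted policy -/

section Atoms

variable {H X A : Type*} [MeasurableSpace H] [MeasurableSpace X] [MetricSpace A]
  [MeasurableSpace A] [SecondCountableTopology A] [BorelSpace A]

theorem measurable_kernel_singleton (κ : Kernel X A) [IsSFiniteKernel κ] {a : X → A}
    (ha : Measurable a) : Measurable fun x => κ x {a x} := by
  have ht : MeasurableSet {z : X × A | z.2 = a z.1} :=
    measurableSet_eq_fun measurable_snd (ha.comp measurable_fst)
  exact Kernel.measurable_kernel_prodMk_left (κ := κ) ht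

/-- The parameters at which the selector `a i` almost surely maximizes, among the finitely many
selectors `a j`, the density of `κ` with respect to `π₀` at the selected point. The ratios of the
masses of the two kernels at these atoms are compared after clearing denominators. -/
def densityArgmaxSet {P : Type*} (d₀ : Measure X) (π₀ : Kernel X A) (κ : Kernel (H × X) A)
    (s : Finset P) (a : P → X → A) (i : P) : Set H :=
  {y | ∀ᵐ x ∂d₀, ∀ j ∈ s, κ (y, x) {a j x} * π₀ x {a i x} ≤ κ (y, x) {a i x} * π₀ x {a j x}}

theorem measurableSet_densityArgmaxSet {P : Type*} (d₀ : Measure X) [SFinite d₀] (π₀ : Kernel X A)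
    [IsSFiniteKernel π₀] (κ : Kernel (H × X) A) [IsSFiniteKernel κ] (s : Finset P) {a : P → X → A}
    (ha : ∀ i, Measurable (a i)) (i : P) :
    MeasurableSet (densityArgmaxSet d₀ π₀ κ s a i) := by
  have hκ : ∀ j, Measurable fun z : H × X => κ z {a j z.2} := fun j =>
    measurable_kernel_singleton κ ((ha j).comp measurable_snd)
  have hπ : ∀ j, Measurable fun z : H × X => π₀ z.2 {a j z.2} := fun j =>
    (measurable_kernel_singleton π₀ (ha j)).comp measurable_snd
  have hS : MeasurableSet {z : H × X | ∀ j ∈ s,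
      κ z {a j z.2} * π₀ z.2 {a i z.2} ≤ κ z {a i z.2} * π₀ z.2 {a j z.2}} := by
    simp only [Set.ofPred_forall]
    exact Finset.measurableSet_biInter s fun j _ =>
      measurableSet_le ((hκ j).mul (hπ i)) ((hκ i).mul (hπ j))
  exact measurable_measure_prodMk_left hS.compl (measurableSet_singleton 0)

end Atoms

namespace Standing

variable {H X A P : Type*} [MeasurableSpace H] [MeasurableSpace X] [MetricSpace A]
  [MeasurableSpace A] [SecondCountableTopology A]
  {d₀ : Measure X} [IsProbabilityMeasure d₀] {π₀ : Kernel X A} [IsMarkovKernel π₀]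
  {R : P → X → A → ℝ} {sel : (X → A → ℝ) → X → A} {δ η : ℝ} (h : Standing d₀ π₀ R sel δ)
include h

omit [IsProbabilityMeasure d₀] in
theorem tiltedPolicy_singleton_mul_le_iff (hη : 0 < η) (q : P) {x : X} {a b : A}
    (ha : 0 < π₀ x {a}) (hb : 0 < π₀ x {b}) :
    tiltedPolicy π₀ η (R q) x {a} * π₀ x {b} ≤ tiltedPolicy π₀ η (R q) x {b} * π₀ x {a} ↔
      R q x a ≤ R q x b := by
  have hZ := integral_exp_pos (h.integrable_exp hη q x)
  have hs : ∀ c : A, tiltedPolicy π₀ η (R q) x {c} =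
      ENNReal.ofReal (Real.exp (η * R q x c) / ∫ a', Real.exp (η * R q x a') ∂(π₀ x)) *
        π₀ x {c} := by
    intro c
    rw [tiltedPolicy, tilted_apply]
    exact lintegral_singleton' (Measurable.ennreal_ofReal
      ((Real.measurable_exp.comp ((h.measurable_apply q x).const_mul η)).div_const _)) c
  rw [hs, hs, mul_assoc, mul_assoc, mul_comm (π₀ x {b}) (π₀ x {a}),
    ENNReal.mul_le_mul_iff_left (mul_ne_zero ha.ne' hb.ne')
      (ENNReal.mul_ne_top (measure_ne_top _ _) (measure_ne_top _ _)),
    ENNReal.ofReal_le_ofReal_iff (by positivity), div_le_div_iff_of_pos_right hZ, Real.exp_le_exp,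
    mul_le_mul_iff_right₀ hη]

omit [IsProbabilityMeasure d₀] in
/-- The selectors of the class are atoms of the reference policy, and the density of a tilted
policy is maximal exactly at its own selector. -/
theorem mem_densityArgmaxSet_iff (hη : 0 < η) (κ : Kernel (H × X) A) {s : Finset P} {q k i : P}
    (hk : k ∈ s) (hqk : sel (R q) =ᵐ[d₀] sel (R k)) {y : H}
    (hy : (fun x => κ (y, x)) = tiltedPolicy π₀ η (R q)) :
    y ∈ densityArgmaxSet d₀ π₀ κ s (fun j => sel (R j)) i ↔ sel (R q) =ᵐ[d₀] sel (R i) := by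
  have hpos : ∀ᵐ x ∂d₀, ∀ j, j ∈ s → 0 < π₀ x {sel (R j) x} :=
    (Filter.eventually_all_finset s).2 fun j _ => h.ae_measure_singleton_sel_pos j
  have hiff : (∀ᵐ x ∂d₀, ∀ j ∈ s, κ (y, x) {sel (R j) x} * π₀ x {sel (R i) x} ≤
        κ (y, x) {sel (R i) x} * π₀ x {sel (R j) x}) ↔
      ∀ᵐ x ∂d₀, ∀ j ∈ s, R q x (sel (R j) x) ≤ R q x (sel (R i) x) := by
    refine Filter.eventually_congr ?_
    filter_upwards [hpos, h.ae_measure_singleton_sel_pos i] with x hx hi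
    refine forall₂_congr fun j hj => ?_
    rw [show κ (y, x) = tiltedPolicy π₀ η (R q) x from congrFun hy x]
    exact h.tiltedPolicy_singleton_mul_le_iff hη q (hx j hj) hi
  refine hiff.trans ⟨?_, ?_⟩
  · intro hle
    refine h.sel_ae_eq_of_ae_le ?_
    filter_upwards [hle, hqk] with x hx hxk
    rw [hxk]
    exact hx k hk
  · intro he
    filter_upwards [he] with x hx j _
    rw [← hx]
    exact (h.selector q).isMax x _ ((h.selector j).mem_support x)

theorem aemeasurable_policyRegret [BorelSpace A] (hη : 0 < η)
    {rew : (X → Measure A) → X → A → ℝ} (hrew : IsInducingReward π₀ η R rew)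
    (κ : Kernel (H × X) A) [IsMarkovKernel κ] {Ω : Type*} [MeasurableSpace Ω] {μ : Measure Ω}
    {Y : Ω → H} (hY : Measurable Y) (p : P)
    (hmem : ∀ᵐ ω ∂μ, (fun x => κ (Y ω, x)) ∈ dpoClass π₀ η R) :
    AEMeasurable (fun ω => policyRegret d₀ π₀ sel rew (R p) fun x => κ (Y ω, x)) μ := by
  obtain ⟨s, hs⟩ := h.exists_finset_sel
  let S : P → Set H := densityArgmaxSet d₀ π₀ κ s fun j => sel (R j)
  have hS : ∀ i, MeasurableSet (S i) := fun i =>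
    measurableSet_densityArgmaxSet d₀ π₀ κ s (fun j => (h.selector j).measurable) i
  -- regrets are nonnegative and the indices whose indicator is one all carry the same regret, so
  -- the supremum of the indicators is the regret of the fitted policy
  let r : s → H → ℝ := fun i => (S i).indicator fun _ => regret d₀ sel (R p) (R i)
  have hr : Measurable fun y => ⨆ i, r i y :=
    Measurable.iSup fun i => measurable_const.indicator (hS i)
  refine ⟨fun ω => ⨆ i, r i (Y ω), hr.comp hY, ?_⟩
  filter_upwards [hmem] with ω hω
  obtain ⟨q, hq⟩ := hω
  obtain ⟨k, hk, hqk⟩ := hs q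
  have hiff : ∀ i, Y ω ∈ S i ↔ sel (R q) =ᵐ[d₀] sel (R i) := fun i =>
    h.mem_densityArgmaxSet_iff hη κ hk hqk hq
  have hreg : ∀ i, Y ω ∈ S i → regret d₀ sel (R p) (R i) = regret d₀ sel (R p) (R q) := fun i hi =>
    (recommendationRegret_congr _ _ ((hiff i).1 hi)).symm
  rw [h.policyRegret_eq hη hrew hq]
  have : Nonempty s := ⟨⟨k, hk⟩⟩
  refine le_antisymm ?_ (ciSup_le fun i => ?_)
  · refine le_trans ?_ (le_ciSup (Set.finite_range _).bddAbove ⟨k, hk⟩)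
    have hkS : Y ω ∈ S k := (hiff k).2 hqk
    simp only [r]
    rw [Set.indicator_of_mem hkS, hreg k hkS]
  · by_cases hi : Y ω ∈ S i
    · simp only [r]
      rw [Set.indicator_of_mem hi, hreg i hi]
    · simp only [r]
      rw [Set.indicator_of_notMem hi]
      exact h.regret_nonneg p q

end Standing

/-! ### Concentration along the interaction -/

/-- The log-loss of the reward `R` on one round of data. -/
noncomputable def obsLoss {X A : Type*} (R : X → A → ℝ) (z : Obs X A) : ℝ :=
  logLoss (score R (z.1, z.2.1)) z.2.2

theorem measurable_obsLoss {X A : Type*} [MeasurableSpace X] [MeasurableSpace A] {R : X → A → ℝ}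
    (hR : Measurable (Function.uncurry R)) : Measurable (obsLoss R) := by
  have h : Measurable fun z : (X × (Fin 2 → A)) × Fin 2 => logLoss (score R z.1) z.2 :=
    measurable_from_prod_countable_left fun k => measurable_logLoss_score hR k
  exact h.comp ((measurable_fst.prodMk (measurable_fst.comp measurable_snd)).prodMk
    (measurable_snd.comp measurable_snd))

theorem measurable_history {X A Ω : Type*} [MeasurableSpace X] [MeasurableSpace A]
    [MeasurableSpace Ω] {Z : ℕ → Ω → Obs X A} (hZ : ∀ t, Measurable (Z t)) (t : ℕ) :
    Measurable (history Z t) :=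
  measurable_pi_lambda _ fun s => hZ s

/-- The policies deployed by online DPO: the reference policy and the policies of the class. -/
def IsCandidate {X A P : Type*} [MeasurableSpace X] [MeasurableSpace A] (π₀ : Kernel X A) (η : ℝ)
    (R : P → X → A → ℝ) (π : X → Measure A) : Prop :=
  π = (fun x => π₀ x) ∨ π ∈ dpoClass π₀ η R

theorem IsCandidate.absolutelyContinuous {X A P : Type*} [MeasurableSpace X] [MeasurableSpace A]
    {π₀ : Kernel X A} {η : ℝ} {R : P → X → A → ℝ} {π : X → Measure A}
    (hπ : IsCandidate π₀ η R π) (x : X) : π x ≪ π₀ x := by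
  rcases hπ with rfl | ⟨q, rfl⟩
  · exact Measure.AbsolutelyContinuous.rfl
  · exact tilted_absolutelyContinuous _ _

/-- The data almost surely avoids any set of actions negligible for the reference policy. -/
theorem ae_obs_mem {X A P Ω : Type*} [MeasurableSpace X] [MeasurableSpace A] [MeasurableSpace Ω]
    {μ : Measure Ω} {d₀ : Measure X} {π₀ : Kernel X A} {η : ℝ} {R : P → X → A → ℝ}
    {Rstar : X → A → ℝ} {pol : Rule X A} [∀ t, IsMarkovKernel (pol t)] {Z : ℕ → Ω → Obs X A}
    (hZ : ∀ t, Measurable (Z t)) (hI : IsInteraction μ d₀ Rstar pol Z)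
    (hpol : ∀ t, ∀ᵐ ω ∂μ, IsCandidate π₀ η R (fittedPolicy pol t (history Z t ω)))
    {G : Set (X × A)} (hG : MeasurableSet G) (hπG : ∀ x, ∀ᵐ a ∂(π₀ x), (x, a) ∈ G) :
    ∀ᵐ ω ∂μ, ∀ t k, ((Z t ω).1, (Z t ω).2.1 k) ∈ G := by
  rw [ae_all_iff]
  intro t
  have hS : MeasurableSet {z : Obs X A | ∀ k, (z.1, z.2.1 k) ∈ G} := by
    simp only [Set.ofPred_forall]
    exact MeasurableSet.iInter fun k => (measurable_fst.prodMk ((measurable_pi_apply k).comp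
      (measurable_fst.comp measurable_snd))) hG
  set S := {z : Obs X A | ∀ k, (z.1, z.2.1 k) ∈ G} with hSdef
  have hf : Measurable (Sᶜ.indicator (1 : Obs X A → ℝ≥0∞)) := measurable_one.indicator hS.compl
  have h0 := hI t (fun _ z => Sᶜ.indicator 1 z) (hf.comp measurable_snd)
  have h1 : ∫⁻ ω, Sᶜ.indicator (1 : Obs X A → ℝ≥0∞) (Z t ω) ∂μ = 0 := by
    rw [h0]
    refine (lintegral_congr_ae ?_).trans lintegral_zero
    filter_upwards [hpol t] with ω hω
    refine (lintegral_congr fun x => ?_).trans lintegral_zero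
    have : ∀ t y x, IsProbabilityMeasure (fittedPolicy pol t y x) := fun t y x => by
      unfold fittedPolicy; infer_instance
    have hx : ∀ᵐ a ∂(Measure.pi fun _ : Fin 2 => fittedPolicy pol t (history Z t ω) x),
        ∀ k, (x, a k) ∈ G := ae_all_iff.2 fun k =>
      (Measure.quasiMeasurePreserving_eval (fun _ => fittedPolicy pol t (history Z t ω) x) k).ae
        ((hω.absolutelyContinuous x).ae_le (hπG x))
    refine (lintegral_congr_ae ?_).trans lintegral_zero
    filter_upwards [hx] with a ha
    refine Finset.sum_eq_zero fun k _ => ?_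
    have hmem : (x, a, k) ∈ S := ha
    rw [Set.indicator_of_notMem (Set.notMem_compl_iff.2 hmem), mul_zero]
  filter_upwards [(lintegral_eq_zero_iff (hf.comp (hZ t))).1 h1] with ω hω
  by_contra hn
  have : Sᶜ.indicator (1 : Obs X A → ℝ≥0∞) (Z t ω) = 0 := hω
  rw [Set.indicator_of_mem (by exact hn)] at this
  exact one_ne_zero this

namespace Standing

variable {X A P : Type*} [MeasurableSpace X] [MetricSpace A] [MeasurableSpace A]
  [SecondCountableTopology A] [BorelSpace A]
  {d₀ : Measure X} [IsProbabilityMeasure d₀] {π₀ : Kernel X A} [IsMarkovKernel π₀]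
  {R : P → X → A → ℝ} {sel : (X → A → ℝ) → X → A} {δ η : ℝ} (h : Standing d₀ π₀ R sel δ)
include h

omit [BorelSpace A] [IsProbabilityMeasure d₀] in
theorem smul_le_of_isCandidate (hη : 0 < η) {π : X → Measure A} (hπ : IsCandidate π₀ η R π)
    (x : X) : ENNReal.ofReal (Real.exp (2 * η * envelope π₀ R))⁻¹ • π₀ x ≤ π x := by
  rcases hπ with rfl | ⟨q, rfl⟩
  · have hle : ENNReal.ofReal (Real.exp (2 * η * envelope π₀ R))⁻¹ ≤ 1 := by
      rw [ENNReal.ofReal_le_one]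
      exact inv_le_one_of_one_le₀ (Real.one_le_exp
        (mul_nonneg (by positivity) (envelope_nonneg π₀ R)))
    refine Measure.le_iff.2 fun s _ => ?_
    rw [Measure.smul_apply, smul_eq_mul]
    exact mul_le_of_le_one_left' hle
  · exact h.smul_le_tiltedPolicy hη q x

/-- Change of measure: under a candidate policy the excess loss is at least `β⁻²` times the excess
loss under the reference policy. -/
theorem le_integral_excessLoss (hη : 0 < η) {κ : Kernel X A} [IsMarkovKernel κ]
    (hκ : IsCandidate π₀ η R fun x => κ x) (p q : P) :
    ((Real.exp (2 * η * envelope π₀ R)) ^ 2)⁻¹ *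
        ∫ z, excessLoss (score (R p) z) (score (R q) z) ∂slateMeasure d₀ π₀ ≤
      ∫ z, excessLoss (score (R p) z) (score (R q) z) ∂slateMeasure d₀ κ := by
  have hle := integral_mono_measure
    (smul_slateMeasure_le (d₀ := d₀) (h.smul_le_of_isCandidate hη hκ))
    (ae_of_all _ fun z => excessLoss_nonneg (score (R p) z) (score (R q) z))
    (h.integrable_excessLoss hκ.absolutelyContinuous p q)
  rwa [integral_smul_measure, ENNReal.toReal_pow, ENNReal.toReal_ofReal (by positivity),
    smul_eq_mul, inv_pow] at hle

omit [IsMarkovKernel π₀] in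
theorem integral_excessLoss_sub_le {κ : Kernel X A} [IsMarkovKernel κ] (hκ : ∀ x, κ x ≪ π₀ x)
    (p : P) {q j : P} {r : ℝ}
    (hr : dist (rewLp h.compactContinuous q) (rewLp h.compactContinuous j) ≤ r) :
    ∫ z, excessLoss (score (R p) z) (score (R q) z) ∂slateMeasure d₀ κ - 2 * r ≤
      ∫ z, excessLoss (score (R p) z) (score (R j) z) ∂slateMeasure d₀ κ := by
  have h1 : ∫ z, (excessLoss (score (R p) z) (score (R q) z) - 2 * r) ∂slateMeasure d₀ κ ≤
      ∫ z, excessLoss (score (R p) z) (score (R j) z) ∂slateMeasure d₀ κ := by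
    refine integral_mono_ae ((h.integrable_excessLoss hκ p q).sub (integrable_const _))
      (h.integrable_excessLoss hκ p j) ?_
    filter_upwards [ae_mem_supportGraph hκ] with z hz
    exact excessLoss_sub_le _ fun l => (abs_sub_le_dist h.compactContinuous q j (hz l)).trans hr
  rwa [integral_sub (h.integrable_excessLoss hκ p q) (integrable_const _), integral_const,
    probReal_univ, one_smul] at h1

omit [IsMarkovKernel π₀] in
/-- Conditional moment generating function of the loss difference in one round. -/
theorem lintegral_exp_obsLoss_le {κ : Kernel X A} [IsMarkovKernel κ] (hκ : ∀ x, κ x ≪ π₀ x)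
    (p j : P) {r m : ℝ} (hr : 0 ≤ r) (hrM : r * (Real.log (2 : ℕ) + 2 * envelope π₀ R) ≤ 1)
    (hm : m ≤ ∫ z, excessLoss (score (R p) z) (score (R j) z) ∂slateMeasure d₀ κ) :
    ∫⁻ x, ∫⁻ a : Fin 2 → A, ∑ k, ENNReal.ofReal (choiceProb (R p) x a k) *
        ENNReal.ofReal (Real.exp (-r * (obsLoss (R j) (x, a, k) - obsLoss (R p) (x, a, k))))
        ∂(Measure.pi fun _ => κ x) ∂d₀ ≤
      ENNReal.ofReal (Real.exp
        (-(r * m) + r ^ 2 * (Real.log (2 : ℕ) + 2 * envelope π₀ R) ^ 2)) := by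
  set M := Real.log (2 : ℕ) + 2 * envelope π₀ R with hM
  let g : X × (Fin 2 → A) → ℝ := fun z => ∑ k, Real.exp (-logLoss (score (R p) z) k) *
    Real.exp (-r * (logLoss (score (R j) z) k - logLoss (score (R p) z) k))
  have hg : Measurable g := Finset.measurable_sum _ fun k _ =>
    (Real.measurable_exp.comp (measurable_logLoss_score (h.measurable p) k).neg).mul
      (Real.measurable_exp.comp (((measurable_logLoss_score (h.measurable j) k).sub
        (measurable_logLoss_score (h.measurable p) k)).const_mul (-r)))
  have hint := h.integrable_excessLoss (d₀ := d₀) hκ p j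
  have hint' : Integrable (fun z => 1 - r * excessLoss (score (R p) z) (score (R j) z) +
      r ^ 2 * M ^ 2) (slateMeasure d₀ κ) :=
    ((integrable_const 1).sub (hint.const_mul r)).add (integrable_const _)
  have hgle : ∀ᵐ z ∂slateMeasure d₀ κ,
      g z ≤ 1 - r * excessLoss (score (R p) z) (score (R j) z) + r ^ 2 * M ^ 2 := by
    filter_upwards [ae_mem_supportGraph hκ] with z hz
    exact sum_exp_mul_exp_le hr hrM
      (abs_logLoss_sub_logLoss_le (h.abs_score_le p hz) (h.abs_score_le j hz))
  calc _ = ∫⁻ z, ENNReal.ofReal (g z) ∂slateMeasure d₀ κ := by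
        rw [lintegral_slateMeasure hg.ennreal_ofReal]
        refine lintegral_congr fun x => lintegral_congr fun a => ?_
        rw [ENNReal.ofReal_sum_of_nonneg fun k _ => by positivity]
        refine Finset.sum_congr rfl fun k _ => ?_
        rw [ENNReal.ofReal_mul (Real.exp_pos _).le, choiceProb_eq_exp_neg_logLoss]
        rfl
    _ ≤ ∫⁻ z, ENNReal.ofReal (1 - r * excessLoss (score (R p) z) (score (R j) z) +
          r ^ 2 * M ^ 2) ∂slateMeasure d₀ κ := by
        refine lintegral_mono_ae ?_
        filter_upwards [hgle] with z hz
        exact ENNReal.ofReal_le_ofReal hz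
    _ = ENNReal.ofReal (∫ z, (1 - r * excessLoss (score (R p) z) (score (R j) z) +
          r ^ 2 * M ^ 2) ∂slateMeasure d₀ κ) := by
        refine (ofReal_integral_eq_lintegral_ofReal hint' ?_).symm
        filter_upwards [hgle] with z hz
        exact (Finset.sum_nonneg fun k _ => by positivity).trans hz
    _ ≤ _ := by
        refine ENNReal.ofReal_le_ofReal ?_
        have hsum : ∫ z, (1 - r * excessLoss (score (R p) z) (score (R j) z) + r ^ 2 * M ^ 2)
            ∂slateMeasure d₀ κ =
            1 - r * ∫ z, excessLoss (score (R p) z) (score (R j) z) ∂slateMeasure d₀ κ +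
              r ^ 2 * M ^ 2 := by
          have hsub : Integrable (fun z => 1 - r * excessLoss (score (R p) z) (score (R j) z))
              (slateMeasure d₀ κ) := (integrable_const 1).sub (hint.const_mul r)
          rw [integral_add hsub (integrable_const _),
            integral_sub (integrable_const 1) (hint.const_mul r), integral_const_mul,
            integral_const, integral_const, probReal_univ, one_smul, one_smul]
        rw [hsum]
        have h1 := mul_le_mul_of_nonneg_left hm hr
        have h2 := Real.add_one_le_exp (-(r * m) + r ^ 2 * M ^ 2)
        linarith

section Interaction

variable {Ω : Type*} [MeasurableSpace Ω] {μ : Measure Ω} [IsProbabilityMeasure μ] {pol : Rule X A}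
  [∀ t, IsMarkovKernel (pol t)] {Z : ℕ → Ω → Obs X A}

omit [IsMarkovKernel π₀] in
/-- The exponential moment of the cumulative loss difference decays geometrically. -/
theorem lintegral_exp_sum_obsLoss_le {p : P}
    (hI : IsInteraction μ d₀ (R p) pol Z)
    (hpol : ∀ t, ∀ᵐ ω ∂μ, IsCandidate π₀ η R (fittedPolicy pol t (history Z t ω)))
    (j : P) {r m : ℝ} (hr : 0 ≤ r) (hrM : r * (Real.log (2 : ℕ) + 2 * envelope π₀ R) ≤ 1)
    (hm : ∀ (κ : Kernel X A) [IsMarkovKernel κ], IsCandidate π₀ η R (fun x => κ x) →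
      m ≤ ∫ z, excessLoss (score (R p) z) (score (R j) z) ∂slateMeasure d₀ κ) (t : ℕ) :
    ∫⁻ ω, ENNReal.ofReal (Real.exp (-r * ∑ s,
        (obsLoss (R j) (history Z t ω s) - obsLoss (R p) (history Z t ω s)))) ∂μ ≤
      ENNReal.ofReal (Real.exp (t *
        (-(r * m) + r ^ 2 * (Real.log (2 : ℕ) + 2 * envelope π₀ R) ^ 2))) := by
  set E := -(r * m) + r ^ 2 * (Real.log (2 : ℕ) + 2 * envelope π₀ R) ^ 2 with hE
  have hD : Measurable fun z : Obs X A => obsLoss (R j) z - obsLoss (R p) z :=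
    (measurable_obsLoss (h.measurable j)).sub (measurable_obsLoss (h.measurable p))
  induction t with
  | zero => simp
  | succ t ih =>
    let W : (Fin t → Obs X A) → ℝ≥0∞ := fun y =>
      ENNReal.ofReal (Real.exp (-r * ∑ s, (obsLoss (R j) (y s) - obsLoss (R p) (y s))))
    let e : Obs X A → ℝ≥0∞ := fun z =>
      ENNReal.ofReal (Real.exp (-r * (obsLoss (R j) z - obsLoss (R p) z)))
    have hW : Measurable W := (Real.measurable_exp.comp ((Finset.measurable_sum _ fun s _ =>
      hD.comp (measurable_pi_apply s)).const_mul (-r))).ennreal_ofReal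
    have he : Measurable e := (Real.measurable_exp.comp (hD.const_mul (-r))).ennreal_ofReal
    calc _ = ∫⁻ ω, W (history Z t ω) * e (Z t ω) ∂μ := by
          refine lintegral_congr fun ω => ?_
          rw [← ENNReal.ofReal_mul (Real.exp_pos _).le, ← Real.exp_add, Fin.sum_univ_castSucc,
            mul_add]
          rfl
      _ = ∫⁻ ω, ∫⁻ x, ∫⁻ a : Fin 2 → A, ∑ k, ENNReal.ofReal (choiceProb (R p) x a k) *
            (W (history Z t ω) * e (x, a, k))
            ∂(Measure.pi fun _ => fittedPolicy pol t (history Z t ω) x) ∂d₀ ∂μ :=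
          hI t (fun y z => W y * e z) ((hW.comp measurable_fst).mul (he.comp measurable_snd))
      _ ≤ ∫⁻ ω, W (history Z t ω) * ENNReal.ofReal (Real.exp E) ∂μ := by
          refine lintegral_mono_ae ?_
          filter_upwards [hpol t] with ω hω
          have hWtop : W (history Z t ω) ≠ ∞ := ENNReal.ofReal_ne_top
          have hpull : ∀ x, ∫⁻ a : Fin 2 → A, ∑ k, ENNReal.ofReal (choiceProb (R p) x a k) *
              (W (history Z t ω) * e (x, a, k))
              ∂(Measure.pi fun _ => fittedPolicy pol t (history Z t ω) x) =
              W (history Z t ω) * ∫⁻ a : Fin 2 → A, ∑ k, ENNReal.ofReal (choiceProb (R p) x a k) *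
                e (x, a, k) ∂(Measure.pi fun _ => fittedPolicy pol t (history Z t ω) x) := by
            intro x
            rw [← lintegral_const_mul' _ _ hWtop]
            refine lintegral_congr fun a => ?_
            rw [Finset.mul_sum]
            exact Finset.sum_congr rfl fun k _ => mul_left_comm _ _ _
          rw [lintegral_congr hpull, lintegral_const_mul' _ _ hWtop]
          refine mul_le_mul_right ?_ _
          exact h.lintegral_exp_obsLoss_le (κ := (pol t).sectR (history Z t ω))
            hω.absolutelyContinuous p j hr hrM (hm _ hω)
      _ = (∫⁻ ω, W (history Z t ω) ∂μ) * ENNReal.ofReal (Real.exp E) :=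
          lintegral_mul_const' _ _ ENNReal.ofReal_ne_top
      _ ≤ ENNReal.ofReal (Real.exp (t * E)) * ENNReal.ofReal (Real.exp E) :=
          mul_le_mul_left ih _
      _ = _ := by
          rw [← ENNReal.ofReal_mul (Real.exp_pos _).le, ← Real.exp_add]
          congr 2
          push_cast
          ring

omit [IsMarkovKernel π₀] in
/-- Chernoff bound for the cumulative loss difference. -/
theorem measure_sum_obsLoss_le (hZ : ∀ t, Measurable (Z t)) {p : P}
    (hI : IsInteraction μ d₀ (R p) pol Z)
    (hpol : ∀ t, ∀ᵐ ω ∂μ, IsCandidate π₀ η R (fittedPolicy pol t (history Z t ω)))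
    (j : P) {r m : ℝ} (hr : 0 ≤ r) (hrM : r * (Real.log (2 : ℕ) + 2 * envelope π₀ R) ≤ 1)
    (hm : ∀ (κ : Kernel X A) [IsMarkovKernel κ], IsCandidate π₀ η R (fun x => κ x) →
      m ≤ ∫ z, excessLoss (score (R p) z) (score (R j) z) ∂slateMeasure d₀ κ) (t : ℕ) (u : ℝ) :
    μ {ω | ∑ s, (obsLoss (R j) (history Z t ω s) - obsLoss (R p) (history Z t ω s)) ≤ t * u} ≤
      ENNReal.ofReal (Real.exp (t *
        (r * u - r * m + r ^ 2 * (Real.log (2 : ℕ) + 2 * envelope π₀ R) ^ 2))) := by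
  have hD : Measurable fun z : Obs X A => obsLoss (R j) z - obsLoss (R p) z :=
    (measurable_obsLoss (h.measurable j)).sub (measurable_obsLoss (h.measurable p))
  have hmeas : Measurable fun ω => ENNReal.ofReal (Real.exp (-r * ∑ s,
      (obsLoss (R j) (history Z t ω s) - obsLoss (R p) (history Z t ω s)))) :=
    (Real.measurable_exp.comp ((Finset.measurable_sum Finset.univ
      fun s : Fin t => fun _ => hD.comp (hZ s)).const_mul (-r))).ennreal_ofReal
  have h1 := (mul_meas_ge_le_lintegral₀ hmeas.aemeasurable
    (ENNReal.ofReal (Real.exp (-r * (t * u))))).trans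
    (h.lintegral_exp_sum_obsLoss_le hI hpol j hr hrM hm t)
  have h2 : μ {ω | ∑ s, (obsLoss (R j) (history Z t ω s) - obsLoss (R p) (history Z t ω s)) ≤
      t * u} ≤ μ {ω | ENNReal.ofReal (Real.exp (-r * (t * u))) ≤
        ENNReal.ofReal (Real.exp (-r * ∑ s,
          (obsLoss (R j) (history Z t ω s) - obsLoss (R p) (history Z t ω s))))} := by
    refine measure_mono fun ω hω => ENNReal.ofReal_le_ofReal (Real.exp_le_exp.2 ?_)
    exact mul_le_mul_of_nonpos_left hω (by linarith)
  refine h2.trans ?_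
  rw [mul_comm, ← ENNReal.le_div_iff_mul_le
    (Or.inl (by simpa using Real.exp_pos _)) (Or.inl ENNReal.ofReal_ne_top)] at h1
  refine h1.trans_eq ?_
  rw [← ENNReal.ofReal_div_of_pos (Real.exp_pos _), ← Real.exp_sub]
  congr 2
  ring

end Interaction

end Standing

/-! ### The regret of online DPO -/

theorem IsOnlineDPO.ae_isCandidate {X A P Ω : Type*} [MeasurableSpace X] [MeasurableSpace A]
    [MeasurableSpace Ω] {μ : Measure Ω} {d₀ : Measure X} {π₀ : Kernel X A} {η : ℝ}
    {R : P → X → A → ℝ} {rew : (X → Measure A) → X → A → ℝ} {Rstar : X → A → ℝ} {pol : Rule X A}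
    {Z : ℕ → Ω → Obs X A} (hO : IsOnlineDPO μ d₀ π₀ η R rew Rstar pol Z) (t : ℕ) :
    ∀ᵐ ω ∂μ, IsCandidate π₀ η R (fittedPolicy pol t (history Z t ω)) := by
  rcases Nat.eq_zero_or_pos t with rfl | ht
  · exact ae_of_all _ fun ω => Or.inl (hO.init _)
  · filter_upwards [hO.mem_class t ht] with ω hω
    exact Or.inr hω

namespace Standing

variable {X A P : Type*} [MeasurableSpace X] [MetricSpace A] [MeasurableSpace A]
  [SecondCountableTopology A] [BorelSpace A]
  {d₀ : Measure X} [IsProbabilityMeasure d₀] {π₀ : Kernel X A} [IsMarkovKernel π₀]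
  {R : P → X → A → ℝ} {sel : (X → A → ℝ) → X → A} {δ η : ℝ} (h : Standing d₀ π₀ R sel δ)
include h

omit [SecondCountableTopology A] [BorelSpace A] [IsProbabilityMeasure d₀] [IsMarkovKernel π₀] in
/-- A smallest net of the reward class at a positive scale. -/
theorem exists_net {r : ℝ} (hr : 0 < r) :
    ∃ C : Finset (lp (fun _ : supportGraph π₀ => ℝ) ∞), C.card = coveringNumber π₀ R r ∧
      (∀ f ∈ C, ∃ j, f = rewLp h.compactContinuous j) ∧
      ∀ q, ∃ f ∈ C, dist (rewLp h.compactContinuous q) f ≤ r := by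
  have hr' : r.toNNReal ≠ 0 := (Real.toNNReal_pos.2 hr).ne'
  have hfin : Metric.coveringNumber r.toNNReal (rewardClass π₀ R) ≠ ⊤ := by
    obtain ⟨t, hts, htf, ht⟩ := h.compactContinuous.compact.finite_cover_balls hr
    refine ne_top_of_le_ne_top (Set.encard_ne_top_iff.2 htf)
      (Metric.IsCover.coveringNumber_le_encard hts fun f hf => ?_)
    obtain ⟨g, hg, hfg⟩ := Set.mem_iUnion₂.1 (ht hf)
    refine ⟨g, hg, ?_⟩
    change edist f g ≤ _
    rw [edist_dist]
    exact ENNReal.ofReal_le_ofReal (Metric.mem_ball.1 hfg).le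
  obtain ⟨C, hCs, hCf, hC, hcard⟩ := Metric.exists_set_encard_eq_coveringNumber hfin
  refine ⟨hCf.toFinset, ?_, fun f hf => exists_eq_rewLp _ (hCs (hCf.mem_toFinset.1 hf)),
    fun q => ?_⟩
  · rw [coveringNumber, ← hcard, hCf.encard_eq_coe_toFinset_card, ENat.toNat_natCast]
  · obtain ⟨f, hf, hqf⟩ := hC (rewLp_mem h.compactContinuous q)
    refine ⟨f, hCf.mem_toFinset.2 hf, ?_⟩
    change edist _ f ≤ ENNReal.ofReal r at hqf
    rwa [edist_dist, ENNReal.ofReal_le_ofReal_iff hr.le] at hqf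

theorem populationLoss_sub_le (p q : P) :
    populationLoss 2 d₀ π₀ (R p) (R q) - populationLoss 2 d₀ π₀ (R p) (R p) ≤
      Real.log (2 : ℕ) + 2 * envelope π₀ R := by
  rw [h.populationLoss_sub]
  have hac : ∀ x, π₀ x ≪ π₀ x := fun x => Measure.AbsolutelyContinuous.rfl
  refine (integral_mono_ae (h.integrable_excessLoss hac p q) (integrable_const
    (Real.log (2 : ℕ) + 2 * envelope π₀ R)) ?_).trans_eq (by simp)
  filter_upwards [ae_mem_supportGraph hac] with z hz
  exact excessLoss_le (h.abs_score_le p hz) (h.abs_score_le q hz)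

section Interaction

variable {Ω : Type*} [MeasurableSpace Ω] {μ : Measure Ω} [IsProbabilityMeasure μ] {pol : Rule X A}
  [∀ t, IsMarkovKernel (pol t)] {Z : ℕ → Ω → Obs X A} {rew : (X → Measure A) → X → A → ℝ}

omit [BorelSpace A] [IsProbabilityMeasure d₀] [IsProbabilityMeasure μ] in
/-- The fitted reward has no larger empirical log-loss than the truth. The reward chosen for the
policy of the truth may differ from the truth, but only on actions that are almost surely never
played. -/
theorem ae_sum_obsLoss_le (hη : 0 < η) (hrew : IsInducingReward π₀ η R rew) {p : P}
    (hO : IsOnlineDPO μ d₀ π₀ η R rew (R p) pol Z) {t : ℕ} (ht : 1 ≤ t) :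
    ∀ᵐ ω ∂μ, ∃ q, fittedPolicy pol t (history Z t ω) = tiltedPolicy π₀ η (R q) ∧
      ∑ s, obsLoss (R q) (history Z t ω s) ≤ ∑ s, obsLoss (R p) (history Z t ω s) := by
  obtain ⟨p', hp', hπp⟩ := hrew _ ⟨p, rfl⟩
  have hG : MeasurableSet {z : X × A | Function.uncurry (R p) z = Function.uncurry (R p') z} :=
    measurableSet_eq_fun (h.measurable p) (h.measurable p')
  filter_upwards [hO.mem_class t ht, hO.isMin t ht, ae_obs_mem hO.measurable hO.interaction
    hO.ae_isCandidate hG (h.ae_eq_of_tiltedPolicy_eq hη hπp)] with ω hmem hmin hdata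
  obtain ⟨q, hq, hπq⟩ := hrew _ hmem
  refine ⟨q, hπq, ?_⟩
  have hle := isMinOn_iff.1 hmin _ ⟨p, rfl⟩
  rw [h.dpoLoss_eq hη hq, h.dpoLoss_eq hη hp'] at hle
  have ht0 : (0 : ℝ) < 1 / t := by
    have : (0 : ℝ) < t := by exact_mod_cast ht
    positivity
  refine (le_of_mul_le_mul_left hle ht0).trans_eq (Finset.sum_congr rfl fun s _ => ?_)
  change logLoss _ _ = logLoss _ _
  congr 1
  funext l
  exact (hdata s l).symm

/-- Exponentially small probability of positive regret: a fitted reward with positive regret lies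
near a point of the net whose conditional mean excess loss is at least `15 γ / 16` in every round,
while its average empirical excess loss is at most `γ / 16`. -/
theorem measure_policyRegret_pos_le (hη : 0 < η) (hrew : IsInducingReward π₀ η R rew) {p : P}
    (hO : IsOnlineDPO μ d₀ π₀ η R rew (R p) pol Z) {ε γ₀ : ℝ}
    (hε : IsolatesRegret d₀ R sel ε) (hγ : IsLossGap 2 d₀ π₀ R sel ε γ₀) {t : ℕ} (ht : 1 ≤ t) :
    μ {ω | 0 < policyRegret d₀ π₀ sel rew (R p) (fittedPolicy pol t (history Z t ω))} ≤
      coveringNumber π₀ R (scaledGap 2 π₀ η R γ₀ / 32) *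
        ENNReal.ofReal (Real.exp (-(t * rateConst 2 π₀ R (scaledGap 2 π₀ η R γ₀)))) := by
  classical
  set γ := scaledGap 2 π₀ η R γ₀ with hγdef
  set M := Real.log (2 : ℕ) + 2 * envelope π₀ R with hM
  have hβ : 1 ≤ Real.exp (2 * η * envelope π₀ R) ^ 2 := one_le_pow₀ (Real.one_le_exp
    (mul_nonneg (by positivity) (envelope_nonneg π₀ R)))
  have hγpos : 0 < γ := mul_pos (by positivity) hγ.1
  have hγle : γ ≤ γ₀ := mul_le_of_le_one_left hγ.1.le (inv_le_one_of_one_le₀ hβ)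
  have hMpos : 0 < M := by
    have := Real.log_pos (x := ((2 : ℕ) : ℝ)) (by norm_num)
    have := envelope_nonneg π₀ R
    positivity
  obtain ⟨C, hCcard, hCrew, hCcov⟩ := h.exists_net (r := γ / 32) (by positivity)
  -- the points of the net near some reward of positive regret: only these have a mean excess loss
  -- bounded below
  let C' := C.filter fun f => ∃ q, ε ≤ regret d₀ sel (R p) (R q) ∧
    dist (rewLp h.compactContinuous q) f ≤ γ / 32
  let E : lp (fun _ : supportGraph π₀ => ℝ) ∞ → Set Ω := fun f => {ω | ∀ j,
    f = rewLp h.compactContinuous j → ∑ s, (obsLoss (R j) (history Z t ω s) -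
      obsLoss (R p) (history Z t ω s)) ≤ t * (γ / 16)}
  have hE : ∀ f ∈ C', μ (E f) ≤ ENNReal.ofReal (Real.exp (-(t * rateConst 2 π₀ R γ))) := by
    intro f hf
    obtain ⟨hfC, q, hq, hdist⟩ := Finset.mem_filter.1 hf
    obtain ⟨j, rfl⟩ := hCrew f hfC
    have hgap := hγ.2 p q hq
    have hγM : γ ≤ M := hγle.trans (hgap.trans (h.populationLoss_sub_le p q))
    rw [h.populationLoss_sub] at hgap
    -- the tilt `γ / (4 M²)` makes the linear term dominate the quadratic one
    have hrM : γ / (4 * M ^ 2) * M ≤ 1 := by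
      rw [div_mul_eq_mul_div, div_le_one (by positivity)]
      nlinarith
    have hm : ∀ (κ : Kernel X A) [IsMarkovKernel κ], IsCandidate π₀ η R (fun x => κ x) →
        15 * γ / 16 ≤ ∫ z, excessLoss (score (R p) z) (score (R j) z) ∂slateMeasure d₀ κ := by
      intro κ _ hκ
      have h1 := h.integral_excessLoss_sub_le (d₀ := d₀) hκ.absolutelyContinuous p hdist
      have h2 := h.le_integral_excessLoss hη hκ p q
      have h3 : γ ≤ ((Real.exp (2 * η * envelope π₀ R)) ^ 2)⁻¹ *
          ∫ z, excessLoss (score (R p) z) (score (R q) z) ∂slateMeasure d₀ π₀ :=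
        mul_le_mul_of_nonneg_left hgap (by positivity)
      linarith
    have hsub : E (rewLp h.compactContinuous j) ⊆ {ω | ∑ s, (obsLoss (R j) (history Z t ω s) -
        obsLoss (R p) (history Z t ω s)) ≤ t * (γ / 16)} := fun ω hω => hω j rfl
    refine (measure_mono hsub).trans ((h.measure_sum_obsLoss_le hO.measurable
      hO.interaction hO.ae_isCandidate j (by positivity) hrM hm t (γ / 16)).trans
      (ENNReal.ofReal_le_ofReal (Real.exp_le_exp.2 ?_)))
    rw [← mul_neg]
    refine mul_le_mul_of_nonneg_left ?_ (Nat.cast_nonneg t)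
    rw [rateConst, ← hM]
    have h4 : γ / (4 * M ^ 2) * (γ / 16) - γ / (4 * M ^ 2) * (15 * γ / 16) +
        (γ / (4 * M ^ 2)) ^ 2 * M ^ 2 = -(5 / 32 * (γ ^ 2 / M ^ 2)) := by
      field_simp
      ring
    have h5 : γ ^ 2 / (128 * M ^ 2) = 1 / 128 * (γ ^ 2 / M ^ 2) := by
      field_simp
    rw [h4, h5]
    have : 0 ≤ γ ^ 2 / M ^ 2 := by positivity
    linarith
  have hsub : ∀ᵐ ω ∂μ, ω ∈ {ω | 0 < policyRegret d₀ π₀ sel rew (R p)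
      (fittedPolicy pol t (history Z t ω))} → ω ∈ ⋃ f ∈ C', E f := by
    filter_upwards [h.ae_sum_obsLoss_le hη hrew hO ht, ae_obs_mem hO.measurable hO.interaction
      hO.ae_isCandidate (measurableSet_supportGraph π₀)
      (fun x => Measure.support_mem_ae (μ := π₀ x))] with ω ⟨q, hπq, hle⟩ hdata hpos
    have hpos' : 0 < regret d₀ sel (R p) (R q) := by
      rw [← h.policyRegret_eq hη hrew hπq]
      exact hpos
    have hεq : ε ≤ regret d₀ sel (R p) (R q) := (hε.2 p q).resolve_left hpos'.ne'
    obtain ⟨f, hf, hdist⟩ := hCcov q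
    refine Set.mem_iUnion₂.2 ⟨f, Finset.mem_filter.2 ⟨hf, q, hεq, hdist⟩, fun j hj => ?_⟩
    rw [hj, dist_comm] at hdist
    have hjq : ∀ s : Fin t, obsLoss (R j) (history Z t ω s) ≤
        obsLoss (R q) (history Z t ω s) + γ / 16 := by
      intro s
      have := logLoss_sub_le (fun l => (abs_sub_le_dist h.compactContinuous j q
        (hdata s l)).trans hdist) (history Z t ω s).2.2
      change obsLoss (R j) (history Z t ω s) - obsLoss (R q) (history Z t ω s) ≤ _ at this
      linarith
    have hsum := Finset.sum_le_sum fun s (_ : s ∈ Finset.univ) => hjq s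
    rw [Finset.sum_add_distrib, Finset.sum_const, Finset.card_univ, Fintype.card_fin,
      nsmul_eq_mul] at hsum
    rw [Finset.sum_sub_distrib]
    linarith
  calc _ ≤ μ (⋃ f ∈ C', E f) := measure_mono_ae hsub
    _ ≤ ∑ f ∈ C', μ (E f) := measure_biUnion_finset_le _ _
    _ ≤ ∑ f ∈ C', ENNReal.ofReal (Real.exp (-(t * rateConst 2 π₀ R γ))) := Finset.sum_le_sum hE
    _ ≤ ∑ f ∈ C, ENNReal.ofReal (Real.exp (-(t * rateConst 2 π₀ R γ))) :=
        Finset.sum_le_sum_of_subset (Finset.filter_subset _ _)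
    _ = _ := by rw [Finset.sum_const, hCcard, nsmul_eq_mul]

omit [BorelSpace A] [IsProbabilityMeasure μ] [∀ t, IsMarkovKernel (pol t)] in
theorem ae_policyRegret_mem_Icc (hη : 0 < η) (hrew : IsInducingReward π₀ η R rew) {p : P}
    (hO : IsOnlineDPO μ d₀ π₀ η R rew (R p) pol Z) (t : ℕ) :
    ∀ᵐ ω ∂μ, policyRegret d₀ π₀ sel rew (R p) (fittedPolicy pol t (history Z t ω)) ∈
      Set.Icc 0 (maxGap π₀ R sel) := by
  filter_upwards [hO.ae_isCandidate t] with ω hω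
  rcases hω with h0 | ⟨q, hq⟩
  · rw [h0, policyRegret, policySelector, if_pos rfl]
    exact ⟨integral_nonneg fun x => sub_nonneg.2
      ((h.selector p).isMax x _ (h.selector_zero.mem_support x)),
      h.recommendationRegret_le p h.selector_zero.measurable h.selector_zero.mem_support⟩
  · rw [h.policyRegret_eq hη hrew hq]
    exact ⟨h.regret_nonneg p q,
      h.recommendationRegret_le p (h.selector q).measurable (h.selector q).mem_support⟩

theorem integrable_policyRegret (hη : 0 < η) (hrew : IsInducingReward π₀ η R rew) {p : P}
    (hO : IsOnlineDPO μ d₀ π₀ η R rew (R p) pol Z) (t : ℕ) :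
    Integrable (fun ω =>
      policyRegret d₀ π₀ sel rew (R p) (fittedPolicy pol t (history Z t ω))) μ := by
  have hm : AEMeasurable (fun ω =>
      policyRegret d₀ π₀ sel rew (R p) (fittedPolicy pol t (history Z t ω))) μ := by
    rcases Nat.eq_zero_or_pos t with rfl | ht
    · simp only [hO.init]
      exact aemeasurable_const
    · exact h.aemeasurable_policyRegret hη hrew (pol t) (measurable_history hO.measurable t) p
        (hO.mem_class t ht)
  refine Integrable.of_bound hm.aestronglyMeasurable (maxGap π₀ R sel) ?_
  filter_upwards [h.ae_policyRegret_mem_Icc hη hrew hO t] with ω hω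
  rw [Real.norm_of_nonneg hω.1]
  exact hω.2

theorem integral_policyRegret_le (hη : 0 < η) (hrew : IsInducingReward π₀ η R rew) {p : P}
    (hO : IsOnlineDPO μ d₀ π₀ η R rew (R p) pol Z) (t : ℕ) :
    ∫ ω, policyRegret d₀ π₀ sel rew (R p) (fittedPolicy pol t (history Z t ω)) ∂μ ≤
      maxGap π₀ R sel *
        μ.real {ω | 0 < policyRegret d₀ π₀ sel rew (R p) (fittedPolicy pol t (history Z t ω))} := by
  set S := {ω | 0 < policyRegret d₀ π₀ sel rew (R p) (fittedPolicy pol t (history Z t ω))} with hS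
  have hint := h.integrable_policyRegret hη hrew hO t
  have hSm : NullMeasurableSet S μ := nullMeasurableSet_lt aemeasurable_const hint.1.aemeasurable
  have hind : ∫ ω, S.indicator (fun _ => maxGap π₀ R sel) ω ∂μ = maxGap π₀ R sel * μ.real S := by
    rw [integral_indicator₀ hSm, setIntegral_const, smul_eq_mul, mul_comm]
  rw [← hind]
  refine integral_mono_ae hint ((integrable_const _).indicator₀ hSm) ?_
  filter_upwards [h.ae_policyRegret_mem_Icc hη hrew hO t] with ω hω
  by_cases hωS : ω ∈ S
  · rw [Set.indicator_of_mem hωS]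
    exact hω.2
  · rw [Set.indicator_of_notMem hωS]
    exact not_lt.1 hωS

theorem sum_integral_policyRegret_le (hη : 0 < η) (hrew : IsInducingReward π₀ η R rew) {p : P}
    (hO : IsOnlineDPO μ d₀ π₀ η R rew (R p) pol Z) {ε γ₀ : ℝ}
    (hε : IsolatesRegret d₀ R sel ε) (hγ : IsLossGap 2 d₀ π₀ R sel ε γ₀) (T : ℕ) :
    ∑ t ∈ Finset.range T,
        ∫ ω, policyRegret d₀ π₀ sel rew (R p) (fittedPolicy pol t (history Z t ω)) ∂μ ≤
      regretBound 2 π₀ η R sel γ₀ := by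
  set γ := scaledGap 2 π₀ η R γ₀ with hγdef
  set c := rateConst 2 π₀ R γ with hc
  set N := coveringNumber π₀ R (γ / 32) with hN
  have hγpos : 0 < γ := mul_pos (by positivity) hγ.1
  have hcpos : 0 < c := by
    have := Real.log_pos (x := ((2 : ℕ) : ℝ)) (by norm_num)
    have := envelope_nonneg π₀ R
    rw [hc, rateConst]
    positivity
  have hN1 : (1 : ℝ) ≤ N := by
    obtain ⟨C, hCcard, -, hCcov⟩ := h.exists_net (r := γ / 32) (by positivity)
    obtain ⟨f, hf, -⟩ := hCcov p
    rw [hN, ← hCcard]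
    exact_mod_cast Finset.card_pos.2 ⟨f, hf⟩
  have hlog : 0 ≤ Real.log (2 * N) := Real.log_nonneg (by linarith)
  obtain ⟨n, hn⟩ := Int.eq_ofNat_of_zero_le
    (Int.ceil_nonneg (mul_nonneg (one_div_nonneg.2 hcpos.le) hlog) :
      0 ≤ ⌈1 / c * Real.log (2 * N)⌉)
  have hcn : Real.log (2 * N) ≤ c * n := by
    have h1 := Int.le_ceil (1 / c * Real.log (2 * N))
    rw [hn, Int.cast_natCast, one_div, inv_mul_le_iff₀ hcpos] at h1
    exact h1
  -- `n` is the number of rounds after which the union bound drops below one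
  let b : ℕ → ℝ := fun t =>
    μ.real {ω | 0 < policyRegret d₀ π₀ sel rew (R p) (fittedPolicy pol t (history Z t ω))}
  have hb : ∀ t, n < t → b t ≤ Real.exp (-(c * ((t : ℝ) - n))) := by
    intro t ht
    have h1 := h.measure_policyRegret_pos_le hη hrew hO hε hγ (t := t) (by omega)
    rw [← hγdef, ← hc, ← hN, ← ENNReal.ofReal_natCast, ← ENNReal.ofReal_mul (by positivity)] at h1
    refine (ENNReal.toReal_le_of_le_ofReal (by positivity) h1).trans ?_
    calc (N : ℝ) * Real.exp (-(t * c)) ≤ Real.exp (c * n) * Real.exp (-(t * c)) := by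
          refine mul_le_mul_of_nonneg_right ?_ (Real.exp_pos _).le
          have h2 := Real.exp_le_exp.2 hcn
          rw [Real.exp_log (by linarith)] at h2
          linarith
      _ = Real.exp (-(c * ((t : ℝ) - n))) := by
          rw [← Real.exp_add]
          congr 1
          ring
  calc _ ≤ ∑ t ∈ Finset.range T, maxGap π₀ R sel * b t :=
        Finset.sum_le_sum fun t _ => h.integral_policyRegret_le hη hrew hO t
    _ = maxGap π₀ R sel * ∑ t ∈ Finset.range T, b t := (Finset.mul_sum _ _ _).symm
    _ ≤ maxGap π₀ R sel * (1 + n + 1 / (Real.exp c - 1)) :=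
        mul_le_mul_of_nonneg_left (sum_le_of_le_one_of_le_exp hcpos n (fun t => measureReal_nonneg)
          (fun t => measureReal_le_one) hb T) h.maxGap_nonneg
    _ = regretBound 2 π₀ η R sel γ₀ := by
        rw [regretBound, ← hγdef, ← hc, ← hN, hn, Int.cast_natCast]

end Interaction

end Standing

end OnlineDPO

theorem mainTheorem2
    {X A P : Type*} [MeasurableSpace X]
    [MetricSpace A] [TopologicalSpace.SeparableSpace A] [MeasurableSpace A] [BorelSpace A]
    (d₀ : Measure X) [IsProbabilityMeasure d₀]
    (π₀ : Kernel X A) [IsMarkovKernel π₀]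
    (η : ℝ) (hη : 0 < η)
    (R : P → X → A → ℝ)
    (hR_meas : ∀ p, Measurable (Function.uncurry (R p)))
    (hR_cent : ∀ p, IsCentered π₀ (R p))
    (sel : (X → A → ℝ) → X → A)
    (hsel : ∀ p, IsSelector π₀ (R p) (sel (R p)))
    (hsel_zero : IsSelector π₀ 0 (sel 0))
    (hC1 : CompactContinuous d₀ π₀ R)
    (hC2 : RewardGap d₀ π₀ R sel)
    (rew : (X → Measure A) → X → A → ℝ)
    (hrew : IsInducingReward π₀ η R rew) :
    -- the recommendation of a policy does not depend on the reward chosen to represent it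
    (∀ p q, tiltedPolicy π₀ η (R p) = tiltedPolicy π₀ η (R q) →
      sel (R p) =ᵐ[d₀] sel (R q)) ∧
    -- the constants entering the bound exist
    (∃ ε₀, IsolatesRegret d₀ R sel ε₀) ∧
    (∀ ε₀, 0 < ε₀ → ∃ γ₀, IsLossGap 2 d₀ π₀ R sel ε₀ γ₀) ∧
    -- the cumulative regret is bounded uniformly in the truth, the learner and the horizon
    (∃ C : ℝ, ∀ (p : P) (Ω : Type*) [MeasurableSpace Ω] (μ : Measure Ω) [IsProbabilityMeasure μ]
      (pol : Rule X A) [∀ t, IsMarkovKernel (pol t)] (Z : ℕ → Ω → Obs X A),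
      IsOnlineDPO μ d₀ π₀ η R rew (R p) pol Z →
      ∀ T : ℕ, 1 ≤ T →
        ∑ t ∈ Finset.range T,
          ∫ ω, policyRegret d₀ π₀ sel rew (R p) (fittedPolicy pol t (history Z t ω)) ∂μ ≤ C) ∧
    -- the explicit bound, together with the existence of the expectations
    (∀ ε₀ γ₀ : ℝ, IsolatesRegret d₀ R sel ε₀ → IsLossGap 2 d₀ π₀ R sel ε₀ γ₀ →
      ∀ (p : P) (Ω : Type*) [MeasurableSpace Ω] (μ : Measure Ω) [IsProbabilityMeasure μ]
        (pol : Rule X A) [∀ t, IsMarkovKernel (pol t)] (Z : ℕ → Ω → Obs X A),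
        IsOnlineDPO μ d₀ π₀ η R rew (R p) pol Z →
        (∀ t, Integrable (fun ω =>
          policyRegret d₀ π₀ sel rew (R p) (fittedPolicy pol t (history Z t ω))) μ) ∧
        ∀ T : ℕ, 1 ≤ T →
          ∑ t ∈ Finset.range T,
            ∫ ω, policyRegret d₀ π₀ sel rew (R p) (fittedPolicy pol t (history Z t ω)) ∂μ ≤
          regretBound 2 π₀ η R sel γ₀) := by
  have : SecondCountableTopology A := UniformSpace.secondCountable_of_separable A
  obtain ⟨δ, hδ, hgap⟩ := hC2
  have h : Standing d₀ π₀ R sel δ := ⟨hR_meas, hR_cent, hsel, hsel_zero, hC1, hδ, hgap⟩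
  refine ⟨fun p q hpq => h.sel_ae_eq_of_tiltedPolicy_eq hη hpq, h.exists_isolatesRegret,
    fun ε₀ hε₀ => h.exists_isLossGap hε₀, ?_, ?_⟩
  · obtain ⟨ε₀, hε₀⟩ := h.exists_isolatesRegret
    obtain ⟨γ₀, hγ₀⟩ := h.exists_isLossGap hε₀.1
    exact ⟨regretBound 2 π₀ η R sel γ₀, fun p Ω _ μ _ pol _ Z hO T _ =>
      h.sum_integral_policyRegret_le hη hrew hO hε₀ hγ₀ T⟩
  · exact fun ε₀ γ₀ hε₀ hγ₀ p Ω _ μ _ pol _ Z hO =>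
      ⟨h.integrable_policyRegret hη hrew hO, fun T _ =>
        h.sum_integral_policyRegret_le hη hrew hO hε₀ hγ₀ T⟩
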